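/- **Setting.** Let $\mathcal T$ be a finite rooted tree whose internal nodes are labelled MAX or MIN, whose root $s_0$ is a MAX node with children $\mathcal C(s_0)$, and let $\mathcal L$ be its set of leaves, $K=|\mathcal L|$, and $\mathcal D(s)\subseteq\mathcal L$ the set of leaves descending from $s$. For $\lambda\in\mathbb R^{\mathcal L}$ let $V_\ell(\lambda)=\lambda_\ell$ for a leaf $\ell$ and let $V_s(\lambda)$ be the maximum (minimum) of $V_c(\lambda)$ over the children $c$ of $s$ if $s$ is a MAX (MIN) node; $V_s(\lambda)$ depends only on $(\lambda_\ell)_{\ell\in\mathcal D(s)}$. Given a threshold $\theta$, put $a_s(\lambda)=$ 'win' if $V_s(\lambda)\ge\theta$ and 'lose' otherwise, and $A_{s_0}(\lambda)=\{c\in\mathcal C(s_0): V_c(\lambda)\ge\theta\}$. Reward laws come from a (non-degenerate, natural) one-parameter exponential family on $\mathbb R$ with densities $f_\eta(y)\propto e^{\eta y}$ with respect to a base measure $\rho$, $\eta$ ranging over the interior of the natural parameter space. It is parametrised by the mean $x\in X$; $X$ also contains the smallest and the largest point charged by $\rho$ if it is an atom of $\rho$, the corresponding law being the point mass there (e.g.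 $X=[0,1]$ for Bernoulli laws). It is assumed that $\rho$-almost every $y$ lies in $X$. Write $f(x,\cdot)$ for the density with mean $x$ and $d(x,y)$ for the Kullback–Leibler divergence between the laws with means $x$ and $y$. Let $\theta\in X$ and let $\mu\in X^{\mathcal L}$ be the unknown mean vector. At round $t=1,2,\dots$ a leaf $I(t)$ is chosen on the basis of the past (and possibly of internal randomisation), and a reward $r(t)$ is observed which, given the past and $I(t)$, has the law with mean $\mu_{I(t)}$. Let $N_\ell(t)$ and $\hat\mu_\ell(t)$ be the number of draws and the sample mean of leaf $\ell$ up to round $t$. For a node $s$ and $\lambda\in X^{\mathcal D(s)}$ let $\Lambda_s(\lambda;t)=\prod_{u\le t,\ I(u)\in\mathcal D(s)} f(\lambda_{I(u)},r(u))$, and $$Z_s(t)=\log\frac{\sup_{\lambda\in X^{\mathcal D(s)}}\Lambda_s(\lambda;t)}{\sup\{\Lambda_s(\lambda;t):\lambda\in X^{\mathcal D(s)},\ a_s(\lambda)\ne a_{s_0}(\hat\mu(t))\}}\in[0,\infty].$$ **Algorithm.** Each leaf is drawn once in rounds $1,\dots,K$. At each round $t>K$: if $N_\ell(t-1)<\sqrt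 t-K/2$ for some leaf, then $I(t)\in\arg\min_\ell N_\ell(t-1)$; otherwise $I(t)\in\arg\max_\ell w_\ell/N_\ell(t-1)$ for some $$w\in\arg\max_{w\in\Delta}\ \inf\Big\{\sum_{\ell}w_\ell\, d(\hat\mu_\ell(t-1),\lambda_\ell):\lambda\in X^{\mathcal L},\ a_{s_0}(\lambda)\neq a_{s_0}(\hat\mu(t-1))\Big\},$$ where $\Delta$ is the probability simplex over $\mathcal L$. Let $$Z^{\mathrm{GAI}}_{s_0}(t)=\begin{cases}\max_{c\in\mathcal C(s_0)}Z_c(t)& (V_{s_0}(\hat\mu(t))\ge\theta),\\ Z_{s_0}(t)&(V_{s_0}(\hat\mu(t))<\theta),\end{cases}$$ $\hat a^{\mathrm{GAI}}(t)\in\arg\max_{c\in\mathcal C(s_0)}Z_c(t)$ if $A_{s_0}(\hat\mu(t))\ne\emptyset$, and $\hat a^{\mathrm{GAI}}(t)=$ "no good action" otherwise. Ties are broken arbitrarily throughout. The algorithm stops at $\tau_\delta=\inf\{t>K: Z^{\mathrm{GAI}}_{s_0}(t)\ge\beta(t,\delta)\}$ and outputs $\hat a^{\mathrm{GAI}}(\tau_\delta)$,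 where $$\beta(t,\delta)=3\sum_{\ell\in\mathcal L}\log(1+\log N_\ell(t))+K\,\mathcal C_{\exp}\!\Big(\frac{\log(1/\delta)}{K}\Big),\qquad \mathcal C_{\exp}(x)=2\tilde h\Big(\frac{h^{-1}(1+x)+\log(\pi^2/3)}{2}\Big),$$ $h(x)=x-\log x$, $h^{-1}$ is its inverse on $[1,\infty)$, and $\tilde h(x)=e^{1/h^{-1}(x)}h^{-1}(x)$ if $x\ge h(1/\log\frac32)$, $\tilde h(x)=\frac32(x-\log\log\frac32)$ otherwise. An output $c\in\mathcal C(s_0)$ is correct if $V_c(\mu)\ge\theta$; the output "no good action" is correct if $A_{s_0}(\mu)=\emptyset$. **Theorem.** For every $\delta>0$, $$\mathbb P\big(\tau_\delta<\infty,\ \hat a^{\mathrm{GAI}}(\tau_\delta)\text{ is not a correct answer}\big)\le\delta.$$ Moreover, let $\mathrm{Alt}^{\mathrm{GAI}}(t)$ be the set of $\lambda\in X^{\mathcal L}$ for which the output $\hat a^{\mathrm{GAI}}(t)$ is incorrect, i.e. $V_{\hat a^{\mathrm{GAI}}(t)}(\lambda)<\theta$ if $\hat a^{\mathrm{GAI}}(t)\in\mathcal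 C(s_0)$ and $V_{s_0}(\lambda)\ge\theta$ if $\hat a^{\mathrm{GAI}}(t)=$ "no good action". Then, almost surely, for all $t\ge K$, the statistic $$\log\frac{\sup_{\lambda\in X^{\mathcal L}}\Lambda_{s_0}(\lambda;t)}{\sup_{\lambda\in\mathrm{Alt}^{\mathrm{GAI}}(t)}\Lambda_{s_0}(\lambda;t)}$$ equals $Z_{s_0}(t)$ if $a_{s_0}(\hat\mu(t))=$ 'lose', and equals $\max_{c\in\mathcal C(s_0)}Z_c(t)$ if $a_{s_0}(\hat\mu(t))=$ 'win'. -/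

import Mathlib

open MeasureTheory ProbabilityTheory Set
open scoped ENNReal

namespace TMCTS

/-! ### Labelled trees -/

/-- Label of an internal node. -/
inductive NodeLabel : Type
  | max
  | min

/-- Finite rooted trees whose internal nodes carry a label and have at least one child. A tree is
identified with its root; the nodes of a tree are the roots of its subtrees. -/
inductive GameTree : Type
  | leaf : GameTree
  | node (label : NodeLabel) (n : ℕ) (child : Fin (n + 1) → GameTree) : GameTree

namespace GameTree

/-- The set of leaves of a tree. For a subtree rooted at `s` this is the set of the leaves that
descend from `s`. -/
def Leaf : GameTree → Type
  | leaf => Unit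
  | node _ n child => Σ i : Fin (n + 1), (child i).Leaf

instance instFintypeLeaf : (T : GameTree) → Fintype T.Leaf
  | leaf => inferInstanceAs (Fintype Unit)
  | node _ n child =>
    have : ∀ i, Fintype (child i).Leaf := fun i => instFintypeLeaf (child i)
    inferInstanceAs (Fintype (Σ i : Fin (n + 1), (child i).Leaf))

instance instDecidableEqLeaf : (T : GameTree) → DecidableEq T.Leaf
  | leaf => inferInstanceAs (DecidableEq Unit)
  | node _ n child =>
    have : ∀ i, DecidableEq (child i).Leaf := fun i => instDecidableEqLeaf (child i)
    inferInstanceAs (DecidableEq (Σ i : Fin (n + 1), (child i).Leaf))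

/-- A leaf below the `i`-th child, as a leaf of the whole tree. -/
def inChild {label : NodeLabel} {n : ℕ} (child : Fin (n + 1) → GameTree) (i : Fin (n + 1))
    (l : (child i).Leaf) : (node label n child).Leaf :=
  (⟨i, l⟩ : Σ i : Fin (n + 1), (child i).Leaf)

/-- The minimax value of the root when the leaves have the values `v`. -/
noncomputable def value : (T : GameTree) → (T.Leaf → ℝ) → ℝ
  | leaf, v => v ()
  | node .max _ child, v =>
    Finset.univ.sup' Finset.univ_nonempty fun i => (child i).value fun l => v (inChild child i l)
  | node .min _ child, v =>
    Finset.univ.inf' Finset.univ_nonempty fun i => (child i).value fun l => v (inChild child i l)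

end GameTree

/-- The two possible answers for a node. -/
inductive Answer : Type
  | win
  | lose

open Classical in
/-- The answer for the root of `T`: it wins iff its value is at least the threshold. -/
noncomputable def answer (θ : ℝ) (T : GameTree) (v : T.Leaf → ℝ) : Answer :=
  if θ ≤ T.value v then .win else .lose

/-! ### One-parameter exponential families, parametrised by the mean -/

/-- The mean of the probability measure with density proportional to `x ↦ exp (η x)` with respect
to `ρ`. -/
noncomputable def tiltedMean (ρ : Measure ℝ) (η : ℝ) : ℝ :=
  ∫ x, x ∂(ρ.tilted fun x => η * x)

/-- `x` is an atom of `ρ` and the smallest or the largest point charged by `ρ`. -/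
def IsExtremeAtom (ρ : Measure ℝ) (x : ℝ) : Prop :=
  0 < ρ {x} ∧ (ρ (Iio x) = 0 ∨ ρ (Ioi x) = 0)

/-- The set of means of the exponential family generated by `ρ`. The extreme atoms are the
means of the degenerate limit laws (for Bernoulli laws: the means `0` and `1`). -/
def meanSpace (ρ : Measure ℝ) : Set ℝ :=
  tiltedMean ρ '' interior (integrableExpSet id ρ) ∪ {x | IsExtremeAtom ρ x}

/-- A one-parameter exponential family on the line, given by its base measure, such that the
rewards (as well as the means) lie in the mean space. -/
structure ExpFamily where
  base : Measure ℝ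
  nonempty_param : (interior (integrableExpSet id base)).Nonempty
  nondegenerate : ¬ ∃ x, ∀ᵐ y ∂base, y = x
  reward_mem : ∀ᵐ y ∂base, y ∈ meanSpace base

namespace ExpFamily

variable (F : ExpFamily)

/-- The set of possible means. -/
def X : Set ℝ := meanSpace F.base

/-- The natural parameter of the member with mean `x`. -/
noncomputable def natParam (x : ℝ) : ℝ :=
  Function.invFunOn (tiltedMean F.base) (interior (integrableExpSet id F.base)) x

open Classical in
/-- The density at `y`, with respect to the base measure, of the member with mean `x`. -/
noncomputable def density (x y : ℝ) : ℝ≥0∞ :=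
  if IsExtremeAtom F.base x then (if y = x then (F.base {x})⁻¹ else 0)
  else ENNReal.ofReal
    (Real.exp (F.natParam x * y) / ∫ z, Real.exp (F.natParam x * z) ∂F.base)

/-- The member of the family with mean `x` (for `x ∈ F.X`). -/
noncomputable def law (x : ℝ) : Measure ℝ := F.base.withDensity (F.density x)

/-- Kullback-Leibler divergence between the members with means `x` and `y`. -/
noncomputable def kl (x y : ℝ) : ℝ≥0∞ := InformationTheory.klDiv (F.law x) (F.law y)

/-- The mean vectors over the leaves of `T`. -/
def meanVectors (T : GameTree) : Set (T.Leaf → ℝ) := {v | ∀ l, v l ∈ F.X}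

/-- The mean vectors over the leaves of `T` for which the answer at the root of `T` is not `a`. -/
def alt (θ : ℝ) (T : GameTree) (a : Answer) : Set (T.Leaf → ℝ) :=
  {v | v ∈ F.meanVectors T ∧ answer θ T v ≠ a}

end ExpFamily

/-! ### Statistics of a sequence of draws

`I u` is the arm drawn and `r u` the reward observed at round `u = 1, 2, …`
(the index `0` is not used). -/

section Statistics

variable {L : Type} [DecidableEq L]

/-- Rounds up to `t` in which `l` was drawn. -/
def drawRounds (I : ℕ → L) (t : ℕ) (l : L) : Finset ℕ := {u ∈ Finset.Icc 1 t | I u = l}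

/-- Number of draws of `l` up to round `t`. -/
def numDraws (I : ℕ → L) (t : ℕ) (l : L) : ℕ := (drawRounds I t l).card

/-- Sample mean of the rewards of `l` up to round `t`. -/
noncomputable def empMean (I : ℕ → L) (r : ℕ → ℝ) (t : ℕ) (l : L) : ℝ :=
  (∑ u ∈ drawRounds I t l, r u) / numDraws I t l

/-- Likelihood of `v`, given the rewards up to round `t` from the leaves of a subtree `S`; the map
`e` sends the leaves of `S` to the leaves of the whole tree. -/
noncomputable def likelihood (F : ExpFamily) (S : GameTree) (e : S.Leaf → L) (I : ℕ → L)
    (r : ℕ → ℝ) (t : ℕ) (v : S.Leaf → ℝ) : ℝ≥0∞ :=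
  ∏ l, ∏ u ∈ drawRounds I t (e l), F.density (v l) (r u)

/-- Logarithm of the ratio of the maximal likelihood and the maximal likelihood over `A`. -/
noncomputable def logLikelihoodRatio (F : ExpFamily) (S : GameTree) (e : S.Leaf → L) (I : ℕ → L)
    (r : ℕ → ℝ) (t : ℕ) (A : Set (S.Leaf → ℝ)) : EReal :=
  ENNReal.log ((⨆ v ∈ F.meanVectors S, likelihood F S e I r t v) /
    (⨆ v ∈ A, likelihood F S e I r t v))

/-- The function `hFun x = x - log x`. -/
noncomputable def hFun (x : ℝ) : ℝ := x - Real.log x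

/-- The inverse of `hFun` on `[1, ∞)`. -/
noncomputable def hInv (x : ℝ) : ℝ := Function.invFunOn hFun (Ici 1) x

open Classical in
noncomputable def hTilde (x : ℝ) : ℝ :=
  if hFun (1 / Real.log (3 / 2)) ≤ x then Real.exp (1 / hInv x) * hInv x
  else 3 / 2 * (x - Real.log (Real.log (3 / 2)))

noncomputable def cExp (x : ℝ) : ℝ :=
  2 * hTilde ((hInv (1 + x) + Real.log (Real.pi ^ 2 / 3)) / 2)

/-- The stopping threshold `β(t, δ)`. -/
noncomputable def threshold [Fintype L] (I : ℕ → L) (t : ℕ) (δ : ℝ) : ℝ :=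
  3 * ∑ l, Real.log (1 + Real.log (numDraws I t l)) +
    Fintype.card L * cExp (Real.log (1 / δ) / Fintype.card L)

end Statistics

/-! ### Ratio-based D-tracking -/

/-- `inf` over the alternatives to the answer for `m` of `∑ w_l d(m_l, v_l)`. -/
noncomputable def weightObjective (F : ExpFamily) (θ : ℝ) (T : GameTree) (m w : T.Leaf → ℝ) :
    ℝ≥0∞ :=
  ⨅ v ∈ F.alt θ T (answer θ T m), ∑ l, ENNReal.ofReal (w l) * F.kl (m l) (v l)

/-- `w` is an optimal allocation for the mean vector `m`. -/
def IsOptimalWeight (F : ExpFamily) (θ : ℝ) (T : GameTree) (m w : T.Leaf → ℝ) : Prop :=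
  w ∈ stdSimplex ℝ T.Leaf ∧
    ∀ w' ∈ stdSimplex ℝ T.Leaf, weightObjective F θ T m w' ≤ weightObjective F θ T m w

/-- The leaf drawn at round `t` complies with ratio-based D-tracking (any tie-breaking). -/
def IsRDTrackingChoice (F : ExpFamily) (θ : ℝ) (T : GameTree) (I : ℕ → T.Leaf) (r : ℕ → ℝ)
    (t : ℕ) : Prop :=
  ((∃ l, (numDraws I (t - 1) l : ℝ) < Real.sqrt t - (Fintype.card T.Leaf : ℝ) / 2) →
    ∀ l, numDraws I (t - 1) (I t) ≤ numDraws I (t - 1) l) ∧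
  ((¬ ∃ l, (numDraws I (t - 1) l : ℝ) < Real.sqrt t - (Fintype.card T.Leaf : ℝ) / 2) →
    ∃ w, IsOptimalWeight F θ T (empMean I r (t - 1)) w ∧
      ∀ l, w l / numDraws I (t - 1) l ≤ w (I t) / numDraws I (t - 1) (I t))

/-- Every leaf is drawn once in the first rounds, and ratio-based D-tracking is followed from then
on. -/
def FollowsRDTracking (F : ExpFamily) (θ : ℝ) (T : GameTree) (I : ℕ → T.Leaf) (r : ℕ → ℝ) :
    Prop :=
  (∀ l, numDraws I (Fintype.card T.Leaf) l = 1) ∧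
    ∀ t, Fintype.card T.Leaf < t → IsRDTrackingChoice F θ T I r t

/-! ### Good action identification at a `MAX` root -/

section GAI

variable (F : ExpFamily) (θ : ℝ) {n : ℕ} (child : Fin (n + 1) → GameTree)

/-- The tree whose root is a `MAX` node with the given children. -/
abbrev maxRoot : GameTree := .node .max n child

/-- The value of the `c`-th child of the root. -/
noncomputable def childValue (c : Fin (n + 1)) (v : (maxRoot child).Leaf → ℝ) : ℝ :=
  (child c).value fun l => v (GameTree.inChild child c l)

/-- The set of good children of the root. -/
def goodChildren (v : (maxRoot child).Leaf → ℝ) : Set (Fin (n + 1)) :=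
  {c | θ ≤ childValue child c v}

/-- Correct outputs for the mean vector `v`; `none` stands for "no good action". -/
def IsCorrectOutput (v : (maxRoot child).Leaf → ℝ) : Option (Fin (n + 1)) → Prop
  | some c => c ∈ goodChildren θ child v
  | none => goodChildren θ child v = ∅

/-- The estimated answer at the root after round `t`. -/
noncomputable def estAnswer (I : ℕ → (maxRoot child).Leaf) (r : ℕ → ℝ) (t : ℕ) : Answer :=
  answer θ (maxRoot child) (empMean I r t)

/-- The GLR statistic of the root for the estimated answer at the root. -/
noncomputable def rootGLR (I : ℕ → (maxRoot child).Leaf) (r : ℕ → ℝ) (t : ℕ) : EReal :=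
  logLikelihoodRatio F (maxRoot child) id I r t
    (F.alt θ (maxRoot child) (estAnswer θ child I r t))

/-- The GLR statistic of the `c`-th child for the estimated answer at the root. -/
noncomputable def childGLR (I : ℕ → (maxRoot child).Leaf) (r : ℕ → ℝ) (t : ℕ)
    (c : Fin (n + 1)) : EReal :=
  logLikelihoodRatio F (child c) (GameTree.inChild child c) I r t
    (F.alt θ (child c) (estAnswer θ child I r t))

/-- The largest GLR statistic of a child of the root. -/
noncomputable def maxChildGLR (I : ℕ → (maxRoot child).Leaf) (r : ℕ → ℝ) (t : ℕ) : EReal :=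
  Finset.univ.sup' Finset.univ_nonempty (childGLR F θ child I r t)

open Classical in
/-- The statistic `Z^GAI` used by the stopping rule. -/
noncomputable def gaiStatistic (I : ℕ → (maxRoot child).Leaf) (r : ℕ → ℝ) (t : ℕ) : EReal :=
  if θ ≤ (maxRoot child).value (empMean I r t) then maxChildGLR F θ child I r t
  else rootGLR F θ child I r t

/-- `out` is an admissible output after round `t`: a child with the largest GLR statistic
(any tie-breaking) if some child is estimated to be good, else "no good action". -/
def IsGAIOutput (I : ℕ → (maxRoot child).Leaf) (r : ℕ → ℝ) (t : ℕ)
    (out : Option (Fin (n + 1))) : Prop :=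
  ((goodChildren θ child (empMean I r t)).Nonempty →
    ∃ c, out = some c ∧ ∀ c', childGLR F θ child I r t c' ≤ childGLR F θ child I r t c) ∧
  (goodChildren θ child (empMean I r t) = ∅ → out = none)

/-- The mean vectors for which the given output is incorrect. -/
def altGAI : Option (Fin (n + 1)) → Set ((maxRoot child).Leaf → ℝ)
  | some c => {v | v ∈ F.meanVectors (maxRoot child) ∧ childValue child c v < θ}
  | none => {v | v ∈ F.meanVectors (maxRoot child) ∧ θ ≤ (maxRoot child).value v}

/-- The GLR statistic against the mean vectors for which the output `out` is incorrect. -/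
noncomputable def gaiGLR (I : ℕ → (maxRoot child).Leaf) (r : ℕ → ℝ) (t : ℕ)
    (out : Option (Fin (n + 1))) : EReal :=
  logLikelihoodRatio F (maxRoot child) id I r t (altGAI F θ child out)

/-- The stopping time: the first round after the initial draws in which the statistic reaches the
threshold (`⊤` if there is none). -/
noncomputable def gaiStoppingTime (δ : ℝ) (I : ℕ → (maxRoot child).Leaf) (r : ℕ → ℝ) : ℕ∞ :=
  ⨅ (t : ℕ) (_ : Fintype.card (maxRoot child).Leaf < t ∧
    (threshold I t δ : EReal) ≤ gaiStatistic F θ child I r t), (t : ℕ∞)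

end GAI

/-! ### The environment -/

/-- The leaf of round `t + 1` is chosen from the information `ℱ t` available after round `t`
(which may include internal randomisation), and given this information the reward of round
`t + 1` has the law of the chosen leaf. -/
structure IsSamplingProcess {Ω : Type*} [MeasurableSpace Ω] (P : Measure Ω)
    (ℱ : Filtration ℕ (inferInstance : MeasurableSpace Ω)) (F : ExpFamily) {L : Type} (μ : L → ℝ)
    (I : ℕ → Ω → L) (r : ℕ → Ω → ℝ) : Prop where
  predictable : ∀ t l, MeasurableSet[ℱ t] {ω | I (t + 1) ω = l}
  adapted : ∀ t, Measurable[ℱ (t + 1)] (r (t + 1))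
  reward_law : ∀ t (B : Set ℝ), MeasurableSet B →
    P⟦r (t + 1) ⁻¹' B | ℱ t⟧ =ᵐ[P] fun ω => (F.law (μ (I (t + 1) ω))).real B

end TMCTS

open TMCTS

/-! If the output is wrong, the true vector `μ` belongs to the alternative against which the
stopping statistic was computed. The statistic is then at most the log of a maximal likelihood over
the likelihood of `μ`, and this bound splits into one-arm factors `armRatio`, each at least one
(`le_prod_armRatio_of_incorrect`). It remains to bound the probability that the product of these
factors over all leaves ever reaches `exp β`.

For one arm with log-ratio `g` after `n` draws, the normalised deviation `Y` (`armDeviation`)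
behaves like an Exp(1) variable, uniformly in time. Cut the values of `n` into slices `[z^i,
z^(i+1)]`. By convexity, each slice has two fixed parameters, one on each side of the true one, such
that one of them almost detects any large `g` (`exists_uniform_slope`, `exists_uniform_param`).
Weighting the corresponding likelihood ratios gives a mixture of unit mass that exceeds `exp (y -
ε)` whenever `Y ≥ y` (`exists_mixture_level`). Summing over a grid of levels dominates `exp (l * Y)`
by a mixture whose mass tends to `1 / (1 - l)`, the exponential moment of Exp(1)
(`exists_mixture_exp`, `tendsto_mixtureMass`). A product of such mixtures over the arms is a
supermartingale under adaptive sampling, because each round alters one factor only. Ville's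
inequality therefore applies (`mul_measure_exists_le_prod`).

Reaching the threshold forces the deviations to sum to at least `K y`, where `h y = 1 + log (1/δ) /
K`; `hTilde` encodes the choice of `z`. The Chernoff bound at `l = 1 - 1/y` is `exp (-K (y - 1)) * y
^ K = δ`.

The identity for the statistic holds because constraining one child leaves the maximisation over the
other children untouched, and their common factor, almost surely nonzero and finite, cancels
(`iSup_likelihood_maxRoot`, `gaiGLR_some_eq_childGLR`). -/

namespace TMCTS

open Filter Topology

/-! ### Exponential families: tangent inequality, densities, degenerate members as limits. -/

namespace ExpFamily

variable (F : ExpFamily)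

/-- The interior of the natural parameter space. -/
def paramSpace : Set ℝ := interior (integrableExpSet id F.base)

/-- The log-partition function. -/
noncomputable def logPartition (η : ℝ) : ℝ := Real.log (∫ z, Real.exp (η * z) ∂F.base)

variable {F}

lemma base_ne_zero : F.base ≠ 0 := fun h => F.nondegenerate ⟨0, by simp [h]⟩

instance : NeZero F.base := ⟨base_ne_zero⟩

lemma integrable_exp {η : ℝ} (hη : η ∈ F.paramSpace) :
    Integrable (fun z => Real.exp (η * z)) F.base :=
  interior_subset (s := integrableExpSet id F.base) hη

lemma integral_exp_pos {η : ℝ} (hη : η ∈ F.paramSpace) :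
    0 < ∫ z, Real.exp (η * z) ∂F.base :=
  MeasureTheory.integral_exp_pos (integrable_exp hη)

lemma exp_logPartition {η : ℝ} (hη : η ∈ F.paramSpace) :
    Real.exp (F.logPartition η) = ∫ z, Real.exp (η * z) ∂F.base :=
  Real.exp_log (integral_exp_pos hη)

lemma base_singleton_ne_top (x : ℝ) : F.base {x} ≠ ⊤ := by
  obtain ⟨η, hη⟩ := F.nonempty_param
  have h := Integrable.measure_ge_lt_top (integrable_exp (F := F) hη) (Real.exp_pos (η * x))
  refine ne_top_of_le_ne_top h.ne (measure_mono ?_)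
  rintro y rfl
  simp

/-- The tangent line of the log-partition function at a parameter lies below it. -/
lemma le_logPartition {η η' : ℝ} (hη : η ∈ F.paramSpace) (hη' : η' ∈ F.paramSpace) :
    F.logPartition η + (η' - η) * tiltedMean F.base η ≤ F.logPartition η' := by
  set ν := F.base.tilted fun x => η * x with hν
  have : IsProbabilityMeasure ν := isProbabilityMeasure_tilted (integrable_exp hη)
  set m := tiltedMean F.base η with hm
  have hid : Integrable (fun y : ℝ => y) ν := by
    have := memLp_tilted_mul (X := id) (μ := F.base) hη 1
    exact memLp_one_iff_integrable.1 (by simpa using! this)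
  have hexp : Integrable (fun y => Real.exp ((η' - η) * y)) ν := by
    rw [hν, integrable_tilted_iff (integrable_exp hη)]
    refine (integrable_exp hη').congr (ae_of_all _ fun y => ?_)
    simp only [smul_eq_mul, ← Real.exp_add]
    ring_nf
  have hval : ∫ y, Real.exp ((η' - η) * y) ∂ν
      = Real.exp (F.logPartition η') / Real.exp (F.logPartition η) := by
    rw [hν, integral_exp_tilted, exp_logPartition hη, exp_logPartition hη']
    congr 2
    ext y
    simp only [Pi.add_apply]
    ring_nf
  have hlin : Integrable (fun y => (η' - η) * (y - m)) ν :=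
    (hid.sub (integrable_const m)).const_mul _
  -- Integrates `1 + u ≤ exp u` for `u = (η' - η)(y - m)`, which is centred under the tilted law.
  have hlow : 1 ≤ ∫ y, Real.exp ((η' - η) * y) * Real.exp (-((η' - η) * m)) ∂ν := by
    have h1 : ∫ y, (1 + (η' - η) * (y - m)) ∂ν = 1 := by
      rw [integral_add (integrable_const _) hlin, integral_const_mul, integral_sub hid (integrable_const _)]
      simp [hm, tiltedMean, hν]
    rw [← h1]
    refine integral_mono ((integrable_const _).add hlin)
      (hexp.mul_const _) fun y => ?_
    simp only [← Real.exp_add]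
    have := Real.add_one_le_exp ((η' - η) * y + -((η' - η) * m))
    linarith
  rw [integral_mul_const, hval, ← Real.exp_sub, ← Real.exp_add] at hlow
  have := Real.one_le_exp_iff.1 hlow
  linarith

lemma natParam_mem {x : ℝ} (hx : x ∈ F.X) (h : ¬ IsExtremeAtom F.base x) :
    F.natParam x ∈ F.paramSpace := by
  rcases hx with hx | hx
  · exact Function.invFunOn_mem hx
  · exact absurd hx h

lemma tiltedMean_natParam {x : ℝ} (hx : x ∈ F.X) (h : ¬ IsExtremeAtom F.base x) :
    tiltedMean F.base (F.natParam x) = x := by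
  rcases hx with hx | hx
  · exact Function.invFunOn_eq hx
  · exact absurd hx h

lemma density_eq_exp {x : ℝ} (hx : x ∈ F.X) (h : ¬ IsExtremeAtom F.base x) (y : ℝ) :
    F.density x y
      = ENNReal.ofReal (Real.exp (F.natParam x * y - F.logPartition (F.natParam x))) := by
  rw [density, if_neg h, Real.exp_sub, exp_logPartition (natParam_mem hx h)]

lemma density_of_extreme {x : ℝ} (h : IsExtremeAtom F.base x) (y : ℝ) :
    F.density x y = if y = x then (F.base {x})⁻¹ else 0 := by
  rw [density, if_pos h]

lemma measurable_density (x : ℝ) : Measurable (F.density x) := by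
  by_cases h : IsExtremeAtom F.base x
  · simp only [funext (density_of_extreme h)]
    exact Measurable.ite (measurableSet_eq_fun measurable_id measurable_const)
      measurable_const measurable_const
  · unfold density
    simp only [if_neg h]
    fun_prop

lemma lintegral_exp_sub_logPartition {η : ℝ} (hη : η ∈ F.paramSpace) :
    ∫⁻ y, ENNReal.ofReal (Real.exp (η * y - F.logPartition η)) ∂F.base = 1 := by
  rw [← ofReal_integral_eq_lintegral_ofReal]
  · simp_rw [Real.exp_sub, div_eq_mul_inv]
    rw [integral_mul_const, ← exp_logPartition hη, mul_inv_cancel₀ (Real.exp_ne_zero _)]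
    simp
  · simp_rw [Real.exp_sub, div_eq_mul_inv]
    exact (integrable_exp hη).mul_const _
  · exact ae_of_all _ fun y => (Real.exp_pos _).le

lemma lintegral_density {x : ℝ} (hx : x ∈ F.X) : ∫⁻ y, F.density x y ∂F.base = 1 := by
  by_cases h : IsExtremeAtom F.base x
  · have : F.density x = ({x} : Set ℝ).indicator fun _ => (F.base {x})⁻¹ := by
      ext y
      simp [density_of_extreme h, Set.indicator_apply]
    rw [this, lintegral_indicator (measurableSet_singleton x), setLIntegral_const,
      ENNReal.inv_mul_cancel h.1.ne' (base_singleton_ne_top x)]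
  · simp_rw [density_eq_exp hx h]
    exact lintegral_exp_sub_logPartition (natParam_mem hx h)

lemma isProbabilityMeasure_law {x : ℝ} (hx : x ∈ F.X) : IsProbabilityMeasure (F.law x) :=
  ⟨by rw [law, withDensity_apply _ MeasurableSet.univ, setLIntegral_univ, lintegral_density hx]⟩

/-- The likelihood ratio of two members of the family integrates to one. -/
lemma lintegral_law_ratio {x η : ℝ} (hx : x ∈ F.X) (h : ¬ IsExtremeAtom F.base x)
    (hη : η ∈ F.paramSpace) :
    ∫⁻ y, ENNReal.ofReal (Real.exp ((η - F.natParam x) * y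
      - (F.logPartition η - F.logPartition (F.natParam x)))) ∂(F.law x) = 1 := by
  rw [law, lintegral_withDensity_eq_lintegral_mul _ (measurable_density x) (by fun_prop),
    ← lintegral_exp_sub_logPartition hη]
  refine lintegral_congr fun y => ?_
  rw [Pi.mul_apply, density_eq_exp hx h, ← ENNReal.ofReal_mul (Real.exp_pos _).le,
    ← Real.exp_add]
  ring_nf

/-- At an extreme atom the partition function is at least the contribution of the atom itself. Any
other `y` is the mean of some parameter, and the tangent line there gives the bound. -/
lemma exists_exponent_le {y : ℝ} (hy : y ∈ F.X) :
    ∃ B : ℝ, ∀ η ∈ F.paramSpace, η * y - F.logPartition η ≤ B := by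
  by_cases h : IsExtremeAtom F.base y
  · refine ⟨-Real.log (F.base.real {y}), fun η hη => ?_⟩
    have hpos : 0 < F.base.real {y} :=
      ENNReal.toReal_pos h.1.ne' (base_singleton_ne_top y)
    have hle : Real.exp (η * y) * F.base.real {y} ≤ Real.exp (F.logPartition η) := by
      rw [exp_logPartition hη]
      calc Real.exp (η * y) * F.base.real {y} = ∫ z in {y}, Real.exp (η * z) ∂F.base := by
            rw [integral_singleton]
            simp [mul_comm]
        _ ≤ _ := setIntegral_le_integral (integrable_exp hη)
            (ae_of_all _ fun z => (Real.exp_pos _).le)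
    have := Real.log_le_log (by positivity) hle
    rw [Real.log_mul (Real.exp_ne_zero _) hpos.ne', Real.log_exp, Real.log_exp] at this
    linarith
  · refine ⟨F.natParam y * y - F.logPartition (F.natParam y), fun η hη => ?_⟩
    have := le_logPartition (natParam_mem hy h) hη
    rw [tiltedMean_natParam hy h] at this
    linarith

lemma exists_density_le {y : ℝ} (hy : y ∈ F.X) :
    ∃ B : ℝ≥0∞, B ≠ ⊤ ∧ ∀ x ∈ F.X, F.density x y ≤ B := by
  obtain ⟨B, hB⟩ := exists_exponent_le hy
  have key : ∀ x ∈ F.X, ¬ IsExtremeAtom F.base x →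
      F.density x y ≤ ENNReal.ofReal (Real.exp B) := fun x hx hxe => by
    rw [density_eq_exp hx hxe]
    exact ENNReal.ofReal_le_ofReal (Real.exp_le_exp.2 (hB _ (natParam_mem hx hxe)))
  by_cases h : IsExtremeAtom F.base y
  · refine ⟨max (ENNReal.ofReal (Real.exp B)) (F.base {y})⁻¹, by simp [h.1.ne'], fun x hx => ?_⟩
    by_cases hxe : IsExtremeAtom F.base x
    · rw [density_of_extreme hxe]
      split_ifs with hyx
      · subst hyx
        exact le_max_right _ _
      · simp
    · exact (key x hx hxe).trans (le_max_left _ _)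
  · refine ⟨ENNReal.ofReal (Real.exp B), by simp, fun x hx => ?_⟩
    by_cases hxe : IsExtremeAtom F.base x
    · rw [density_of_extreme hxe, if_neg]
      · simp
      · rintro rfl
        exact h hxe
    · exact key x hx hxe

/-- The parameter is sent to infinity towards the side of the atom: `s = ±1` is such that `s * (z -
x) ≤ 0` almost everywhere, so the integrands decrease to the indicator of `{x}`, dominated by the
one with `k = 0`. -/
lemma tendsto_integral_exp_extreme {x : ℝ} (hx : IsExtremeAtom F.base x) :
    ∃ u : ℕ → ℝ, (∀ k, u k ∈ F.paramSpace) ∧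
      Tendsto (fun k => ∫ z, Real.exp (u k * (z - x)) ∂F.base) atTop (𝓝 (F.base.real {x})) := by
  obtain ⟨η₀, hη₀⟩ := F.nonempty_param
  obtain ⟨s, hs0, hs⟩ : ∃ s : ℝ, s ≠ 0 ∧ ∀ᵐ z ∂F.base, s * (z - x) ≤ 0 := by
    rcases hx.2 with h | h
    · refine ⟨-1, by norm_num, ?_⟩
      have : ∀ᵐ z ∂F.base, z ∉ Iio x := measure_eq_zero_iff_ae_notMem.1 h
      filter_upwards [this] with z hz
      simp only [mem_Iio, not_lt] at hz
      linarith
    · refine ⟨1, by norm_num, ?_⟩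
      have : ∀ᵐ z ∂F.base, z ∉ Ioi x := measure_eq_zero_iff_ae_notMem.1 h
      filter_upwards [this] with z hz
      simp only [mem_Ioi, not_lt] at hz
      linarith
  have hadd : ∀ η ∈ integrableExpSet id F.base, ∀ c : ℝ, 0 ≤ c →
      η + c * s ∈ integrableExpSet id F.base := by
    intro η hη c hc
    have hη' : Integrable (fun z => Real.exp (η * z)) F.base := hη
    change Integrable (fun z => Real.exp ((η + c * s) * z)) F.base
    refine (hη'.mul_const (Real.exp (c * (s * x)))).mono' (by
      exact (by fun_prop : Measurable fun z : ℝ => Real.exp ((η + c * s) * z)).aestronglyMeasurable)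
      ?_
    filter_upwards [hs] with z hz
    rw [Real.norm_of_nonneg (Real.exp_pos _).le, ← Real.exp_add, Real.exp_le_exp]
    nlinarith [mul_nonpos_of_nonneg_of_nonpos hc hz]
  -- Translation by `c * s` maps the natural parameter set into itself, hence also its interior.
  have hmem : ∀ c : ℝ, 0 ≤ c → η₀ + c * s ∈ F.paramSpace := by
    intro c hc
    rw [paramSpace, mem_interior]
    refine ⟨(fun t => t - c * s) ⁻¹' interior (integrableExpSet id F.base), fun t ht => ?_,
      isOpen_interior.preimage (by fun_prop), by simpa using hη₀⟩
    have := hadd _ (interior_subset ht) c hc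
    simpa using this
  refine ⟨fun k => η₀ + k * s, fun k => hmem k (Nat.cast_nonneg k), ?_⟩
  have hlim : ∫ z, ({x} : Set ℝ).indicator (fun _ => (1 : ℝ)) z ∂F.base = F.base.real {x} := by
    rw [integral_indicator (measurableSet_singleton x)]
    simp [Measure.real]
  rw [← hlim]
  refine tendsto_integral_of_dominated_convergence (fun z => Real.exp (η₀ * (z - x)))
    (fun k => (by fun_prop : Measurable fun z : ℝ =>
      Real.exp ((η₀ + k * s) * (z - x))).aestronglyMeasurable) ?_ (fun k => ?_) ?_
  · refine ((integrable_exp (F := F) hη₀).mul_const (Real.exp (-(η₀ * x)))).congr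
      (ae_of_all _ fun z => ?_)
    simp only [← Real.exp_add]
    ring_nf
  · filter_upwards [hs] with z hz
    rw [Real.norm_of_nonneg (Real.exp_pos _).le, Real.exp_le_exp]
    nlinarith [mul_nonpos_of_nonneg_of_nonpos (Nat.cast_nonneg (α := ℝ) k) hz]
  · filter_upwards [hs] with z hz
    by_cases hzx : z = x
    · simp [hzx]
    · have hneg : s * (z - x) < 0 := lt_of_le_of_ne hz (mul_ne_zero hs0 (sub_ne_zero.2 hzx))
      simp only [Set.indicator_apply, mem_singleton_iff, hzx, if_false]
      refine Real.tendsto_exp_atBot.comp ?_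
      have : (fun k : ℕ => (η₀ + k * s) * (z - x))
          = fun k : ℕ => η₀ * (z - x) + (k : ℝ) * (s * (z - x)) := by
        ext k; ring
      rw [this]
      exact tendsto_atBot_add_const_left _ _
        (tendsto_natCast_atTop_atTop.atTop_mul_const_of_neg hneg)

/-- The density of the point mass at an extreme atom is a limit of densities of members with
parameters in `paramSpace`. -/
lemma exists_lt_exponent_of_extreme {x b : ℝ} (hx : IsExtremeAtom F.base x)
    (hb : b < -Real.log (F.base.real {x})) :
    ∃ η ∈ F.paramSpace, b < η * x - F.logPartition η := by
  obtain ⟨u, hu, hlim⟩ := tendsto_integral_exp_extreme hx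
  have hpos : 0 < F.base.real {x} := ENNReal.toReal_pos hx.1.ne' (base_singleton_ne_top x)
  have hlog := (hlim.log hpos.ne').neg
  obtain ⟨k, hk⟩ := (hlog.eventually_const_lt hb).exists
  refine ⟨u k, hu k, hk.trans_eq ?_⟩
  have : ∫ z, Real.exp (u k * (z - x)) ∂F.base
      = Real.exp (F.logPartition (u k)) * Real.exp (-(u k * x)) := by
    rw [exp_logPartition (hu k), ← integral_mul_const]
    refine integral_congr_ae (ae_of_all _ fun z => ?_)
    simp only [← Real.exp_add]
    ring_nf
  rw [this, ← Real.exp_add, Real.log_exp]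
  ring

/-- A measurable set of means that contains almost every reward. -/
lemma exists_measurable_rewards (F : ExpFamily) :
    ∃ R : Set ℝ, MeasurableSet R ∧ R ⊆ F.X ∧ F.base Rᶜ = 0 := by
  refine ⟨(toMeasurable F.base F.Xᶜ)ᶜ, (measurableSet_toMeasurable _ _).compl, ?_, ?_⟩
  · rw [compl_subset_comm]
    exact subset_toMeasurable _ _
  · rw [compl_compl, measure_toMeasurable]
    exact F.reward_mem

end ExpFamily

/-! ### A convexity lemma for suprema of affine functions. -/

/-- If a supremum of affine functions with nonnegative slopes is finite and at least `a`, then, up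
to `ε`, this is witnessed by a slope that does not depend on the point. -/
lemma exists_uniform_slope {Λ : Set ℝ} (hΛ : ∀ l ∈ Λ, 0 ≤ l) (hne : Λ.Nonempty) (φ : ℝ → ℝ)
    {a ε m₀ : ℝ} (ha : 0 < a) (hε : 0 < ε) (hm₀ : ∀ l ∈ Λ, l * m₀ ≤ φ l) :
    ∃ l ∈ Λ, ∀ m, (∃ B, ∀ l' ∈ Λ, l' * m - φ l' ≤ B) →
      (∀ b < a, ∃ l' ∈ Λ, b < l' * m - φ l') → a - ε ≤ l * m - φ l := by
  set D : Set ℝ := {m | (∃ B, ∀ l' ∈ Λ, l' * m - φ l' ≤ B) ∧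
    ∀ b < a, ∃ l' ∈ Λ, b < l' * m - φ l'} with hD
  by_cases hDne : D.Nonempty
  swap
  · obtain ⟨l, hl⟩ := hne
    exact ⟨l, hl, fun m h1 h2 => absurd ⟨m, h1, h2⟩ hDne⟩
  -- To the left of `m₀` all the affine functions are nonpositive, whereas `a > 0`.
  have hbdd : BddBelow D := by
    refine ⟨m₀, fun m hm => ?_⟩
    by_contra! hlt
    obtain ⟨l, hl, hl'⟩ := hm.2 0 ha
    nlinarith [hm₀ l hl, mul_le_mul_of_nonneg_left hlt.le (hΛ l hl)]
  set ms := sInf D with hms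
  -- Since slopes are nonnegative, a slope that works at the infimum of `D` works on all of `D`. The
  -- infimum need not belong to `D`.
  suffices h : ∃ l ∈ Λ, a - ε ≤ l * ms - φ l by
    obtain ⟨l, hl, h⟩ := h
    refine ⟨l, hl, fun m h1 h2 => h.trans ?_⟩
    have : ms ≤ m := csInf_le hbdd ⟨h1, h2⟩
    nlinarith [mul_le_mul_of_nonneg_left this (hΛ l hl)]
  by_contra! hcon
  obtain ⟨m₁, hm₁⟩ := hDne
  obtain ⟨B, hB⟩ := hm₁.1
  have hBa : a ≤ B := by
    refine le_of_forall_lt fun b hb => ?_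
    obtain ⟨l, hl, h⟩ := hm₁.2 b hb
    exact h.trans_le (hB l hl)
  -- Chosen so that `(1 - s)(a - ε) + s B = a - ε / 2`: if no slope worked at `ms`, the supremum
  -- would stay below `a` up to `ms + s (m₁ - ms)`, contradicting the choice of `ms`.
  set s : ℝ := ε / 2 / (B - a + ε) with hs
  have hs0 : 0 < s := div_pos (by linarith) (by linarith)
  have hsB : s * (B - a + ε) = ε / 2 := div_mul_cancel₀ _ (by linarith)
  have hs1 : s ≤ 1 := by
    rw [hs, div_le_one (by linarith)]
    linarith
  have hle : ∀ l ∈ Λ, l * (ms + s * (m₁ - ms)) - φ l ≤ a - ε / 2 := by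
    intro l hl
    have h1 := mul_le_mul_of_nonneg_left (hB l hl) hs0.le
    have h2 := mul_le_mul_of_nonneg_left (hcon l hl).le (sub_nonneg.2 hs1)
    nlinarith
  have hmle : ms ≤ m₁ := csInf_le hbdd hm₁
  have hnot : ∀ m ∈ D, ms + s * (m₁ - ms) < m := by
    intro m hm
    by_contra! hlt
    obtain ⟨l, hl, h⟩ := hm.2 (a - ε / 2) (by linarith)
    have := hle l hl
    nlinarith [mul_le_mul_of_nonneg_left hlt (hΛ l hl)]
  have h1 := hnot m₁ hm₁
  have hlt : ms < m₁ := by nlinarith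
  have h2 : ms + s * (m₁ - ms) ≤ sInf D := le_csInf ⟨m₁, hm₁⟩ fun m hm => (hnot m hm).le
  nlinarith [mul_pos hs0 (sub_pos.2 hlt)]

/-! ### Mixtures of product likelihood ratios. -/

/-- `M` is a countable mixture, of total mass at most `C`, of products of functions with integral
at most one. -/
def IsMixture (ν : Measure ℝ) (C : ℝ≥0∞) (M : Finset ℕ → (ℕ → ℝ) → ℝ≥0∞) : Prop :=
  ∃ (κ : Type) (_ : Countable κ) (c : κ → ℝ≥0∞) (q : κ → ℝ → ℝ≥0∞),
    (∀ k, Measurable (q k)) ∧ (∀ k, ∫⁻ y, q k y ∂ν ≤ 1) ∧ ∑' k, c k ≤ C ∧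
      ∀ s r, M s r = ∑' k, c k * ∏ u ∈ s, q k (r u)

namespace IsMixture

variable {ν : Measure ℝ}

lemma const [IsProbabilityMeasure ν] (C : ℝ≥0∞) : IsMixture ν C fun _ _ => C :=
  ⟨Unit, inferInstance, fun _ => C, fun _ _ => 1, fun _ => measurable_const, by simp, by simp,
    by simp⟩

lemma prod {q : ℝ → ℝ≥0∞} (hq : Measurable q) (h : ∫⁻ y, q y ∂ν ≤ 1) :
    IsMixture ν 1 fun s r => ∏ u ∈ s, q (r u) :=
  ⟨Unit, inferInstance, fun _ => 1, fun _ => q, fun _ => hq, fun _ => h, by simp, by simp⟩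

lemma tsum {ι : Type} [Countable ι] {C : ι → ℝ≥0∞} {M : ι → Finset ℕ → (ℕ → ℝ) → ℝ≥0∞}
    (a : ι → ℝ≥0∞) (h : ∀ i, IsMixture ν (C i) (M i)) :
    IsMixture ν (∑' i, a i * C i) fun s r => ∑' i, a i * M i s r := by
  choose κ hκ c q hq hq1 hc hM using h
  refine ⟨Σ i, κ i, inferInstance, fun p => a p.1 * c p.1 p.2, fun p => q p.1 p.2,
    fun p => hq _ _, fun p => hq1 _ _, ?_, fun s r => ?_⟩
  · rw [ENNReal.tsum_sigma']
    refine ENNReal.tsum_le_tsum fun i => ?_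
    change ∑' k, a i * c i k ≤ _
    rw [ENNReal.tsum_mul_left]
    gcongr
    exact hc i
  · rw [ENNReal.tsum_sigma']
    refine tsum_congr fun i => ?_
    simp only [mul_assoc]
    rw [ENNReal.tsum_mul_left, hM]

lemma add {C C' : ℝ≥0∞} {M M' : Finset ℕ → (ℕ → ℝ) → ℝ≥0∞} (h : IsMixture ν C M)
    (h' : IsMixture ν C' M') : IsMixture ν (C + C') fun s r => M s r + M' s r := by
  have := tsum (ν := ν) (ι := Bool) (C := fun i => cond i C C') (M := fun i => cond i M M')
    (fun _ => 1) (by rintro (_ | _); exacts [h', h])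
  simpa [tsum_bool, add_comm] using this

end IsMixture

/-! ### Detecting a large one-arm likelihood ratio with two fixed parameters. -/

/-- The maximal likelihood of the rewards `r u`, `u ∈ s`, over their likelihood for `x`. -/
noncomputable def armRatio (F : ExpFamily) (x : ℝ) (s : Finset ℕ) (r : ℕ → ℝ) : ℝ≥0∞ :=
  (⨆ x' ∈ F.X, ∏ u ∈ s, F.density x' (r u)) / ∏ u ∈ s, F.density x (r u)

namespace ExpFamily

variable {F : ExpFamily}

/-- The exponent of the likelihood ratio of the members with natural parameters `η` and `η₀`. -/
noncomputable def tilt (F : ExpFamily) (η₀ η m : ℝ) : ℝ :=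
  (η - η₀) * m - (F.logPartition η - F.logPartition η₀)

/-- In `m`, the exponents are affine with slopes of both signs. Splitting at `η₀` and reflecting one
half reduces to nonnegative slopes. The true mean `x` serves as `m₀`, because the tangent inequality
makes all exponents nonpositive there. -/
lemma exists_uniform_param {x a ε : ℝ} (hx : x ∈ F.X) (h : ¬ IsExtremeAtom F.base x) (ha : 0 < a)
    (hε : 0 < ε) :
    ∃ η : Bool → ℝ, (∀ i, η i ∈ F.paramSpace) ∧
      ∀ m, (∃ B, ∀ η' ∈ F.paramSpace, F.tilt (F.natParam x) η' m ≤ B) →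
      (∀ b < a, ∃ η' ∈ F.paramSpace, b < F.tilt (F.natParam x) η' m) →
      ∃ i, a - ε ≤ F.tilt (F.natParam x) (η i) m := by
  set η₀ := F.natParam x with hη₀
  have h0 := natParam_mem hx h
  have htan : ∀ η ∈ F.paramSpace, (η - η₀) * x ≤ F.logPartition η - F.logPartition η₀ := by
    intro η hη
    have := le_logPartition h0 hη
    rw [tiltedMean_natParam hx h] at this
    linarith
  obtain ⟨l₁, hl₁, H₁⟩ := exists_uniform_slope (Λ := {l | 0 ≤ l ∧ η₀ + l ∈ F.paramSpace})
    (fun l hl => hl.1) ⟨0, le_rfl, by simpa using h0⟩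
    (fun l => F.logPartition (η₀ + l) - F.logPartition η₀) (m₀ := x) ha hε (fun l hl => by
      simpa using htan _ hl.2)
  obtain ⟨l₂, hl₂, H₂⟩ := exists_uniform_slope (Λ := {l | 0 ≤ l ∧ η₀ - l ∈ F.paramSpace})
    (fun l hl => hl.1) ⟨0, le_rfl, by simpa using h0⟩
    (fun l => F.logPartition (η₀ - l) - F.logPartition η₀) (m₀ := -x) ha hε (fun l hl => by
      simpa using htan _ hl.2)
  refine ⟨fun i => cond i (η₀ + l₁) (η₀ - l₂), by rintro (_ | _); exacts [hl₂.2, hl₁.2], ?_⟩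
  rintro m ⟨B, hB⟩ hm
  have hcase : (∀ b < a, ∃ l ∈ {l | 0 ≤ l ∧ η₀ + l ∈ F.paramSpace},
        b < l * m - (F.logPartition (η₀ + l) - F.logPartition η₀)) ∨
      (∀ b < a, ∃ l ∈ {l | 0 ≤ l ∧ η₀ - l ∈ F.paramSpace},
        b < l * (-m) - (F.logPartition (η₀ - l) - F.logPartition η₀)) := by
    by_contra! hcon
    obtain ⟨⟨b₁, hb₁, h₁⟩, b₂, hb₂, h₂⟩ := hcon
    obtain ⟨η, hη, hlt⟩ := hm (max b₁ b₂) (max_lt hb₁ hb₂)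
    rw [max_lt_iff, tilt] at hlt
    rcases le_total η₀ η with hle | hle
    · have := h₁ (η - η₀) ⟨sub_nonneg.2 hle, by simpa using hη⟩
      rw [add_sub_cancel] at this
      linarith
    · have := h₂ (η₀ - η) ⟨sub_nonneg.2 hle, by simpa using hη⟩
      rw [sub_sub_cancel] at this
      linarith
  rcases hcase with hc | hc
  · refine ⟨true, ?_⟩
    have := H₁ m ⟨B, fun l hl => by simpa [tilt] using hB _ hl.2⟩ hc
    simpa [tilt] using this
  · refine ⟨false, ?_⟩
    have := H₂ (-m) ⟨B, fun l hl => by simpa [tilt] using hB _ hl.2⟩ hc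
    simpa [tilt] using this

lemma prod_density_eq {x : ℝ} (hx : x ∈ F.X) (h : ¬ IsExtremeAtom F.base x) (s : Finset ℕ)
    (r : ℕ → ℝ) :
    ∏ u ∈ s, F.density x (r u) = ENNReal.ofReal (Real.exp
      (F.natParam x * ∑ u ∈ s, r u - s.card * F.logPartition (F.natParam x))) := by
  simp_rw [density_eq_exp hx h]
  rw [← ENNReal.ofReal_prod_of_nonneg fun _ _ => (Real.exp_pos _).le, ← Real.exp_sum,
    Finset.sum_sub_distrib, Finset.mul_sum]
  simp

lemma prod_tilt (F : ExpFamily) (η₀ η : ℝ) (s : Finset ℕ) (hs : s.Nonempty) (r : ℕ → ℝ) :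
    ∏ u ∈ s, ENNReal.ofReal (Real.exp (F.tilt η₀ η (r u)))
      = ENNReal.ofReal (Real.exp (s.card * F.tilt η₀ η ((∑ u ∈ s, r u) / s.card))) := by
  rw [← ENNReal.ofReal_prod_of_nonneg fun _ _ => (Real.exp_pos _).le, ← Real.exp_sum]
  have : (s.card : ℝ) ≠ 0 := by exact_mod_cast hs.card_pos.ne'
  simp only [tilt]
  rw [Finset.sum_sub_distrib, ← Finset.mul_sum]
  simp only [Finset.sum_const, nsmul_eq_mul]
  congr 2
  field_simp

/-- The supremum in `armRatio` also runs over point masses. One that contributes forces all rewards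
to equal its atom, and is then a limit of regular members; the strict inequality leaves room for the
approximation. -/
lemma exists_lt_tilt {x b : ℝ} (hx : x ∈ F.X) (h : ¬ IsExtremeAtom F.base x) {s : Finset ℕ}
    (hs : s.Nonempty) {r : ℕ → ℝ} (hb : ENNReal.ofReal (Real.exp b) < armRatio F x s r) :
    ∃ η ∈ F.paramSpace, b < s.card * F.tilt (F.natParam x) η ((∑ u ∈ s, r u) / s.card) := by
  have hn : (0 : ℝ) < s.card := by exact_mod_cast hs.card_pos
  rw [armRatio, prod_density_eq hx h, ENNReal.lt_div_iff_mul_lt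
    (Or.inl (by simp [Real.exp_pos])) (Or.inl (by simp)), ← ENNReal.ofReal_mul (Real.exp_pos _).le,
    ← Real.exp_add] at hb
  simp only [lt_iSup_iff] at hb
  obtain ⟨x', hx', hb⟩ := hb
  have hval : ∀ η, s.card * F.tilt (F.natParam x) η ((∑ u ∈ s, r u) / s.card)
      = (η * ∑ u ∈ s, r u - s.card * F.logPartition η)
        - (F.natParam x * ∑ u ∈ s, r u - s.card * F.logPartition (F.natParam x)) := by
    intro η
    rw [tilt]
    field_simp
    ring
  by_cases hxe : IsExtremeAtom F.base x'
  · have hall : ∀ u ∈ s, r u = x' := by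
      intro u hu
      by_contra hne
      rw [Finset.prod_eq_zero hu (by rw [density_of_extreme hxe, if_neg hne])] at hb
      simp at hb
    have hpos : 0 < F.base.real {x'} := ENNReal.toReal_pos hxe.1.ne' (base_singleton_ne_top x')
    have hsum : ∑ u ∈ s, r u = s.card * x' := by
      rw [Finset.sum_congr rfl hall]
      simp
    have hprod : ∏ u ∈ s, F.density x' (r u)
        = ENNReal.ofReal (Real.exp (s.card * -Real.log (F.base.real {x'}))) := by
      rw [Finset.prod_congr rfl fun u hu => by rw [density_of_extreme hxe, if_pos (hall u hu)],
        Finset.prod_const, Real.exp_nat_mul, Real.exp_neg, Real.exp_log hpos,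
        ENNReal.ofReal_pow (by positivity), ENNReal.ofReal_inv_of_pos hpos, Measure.real,
        ENNReal.ofReal_toReal (base_singleton_ne_top x')]
    rw [hprod, ENNReal.ofReal_lt_ofReal_iff (Real.exp_pos _), Real.exp_lt_exp, hsum] at hb
    obtain ⟨η, hη, hlt⟩ := exists_lt_exponent_of_extreme (F := F) (x := x')
      (b := b / s.card + (F.natParam x * x' - F.logPartition (F.natParam x))) hxe (by
        have h3 : s.card * (b / s.card + (F.natParam x * x' - F.logPartition (F.natParam x)))
            < s.card * -Real.log (F.base.real {x'}) := by
          refine lt_of_eq_of_lt ?_ hb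
          field_simp
        exact lt_of_mul_lt_mul_left h3 hn.le)
    refine ⟨η, hη, ?_⟩
    rw [hval, hsum]
    have h4 := mul_lt_mul_of_pos_left hlt hn
    have h5 : (s.card : ℝ) * (b / s.card + (F.natParam x * x' - F.logPartition (F.natParam x)))
        = b + s.card * (F.natParam x * x' - F.logPartition (F.natParam x)) := by
      field_simp
    rw [h5] at h4
    linarith
  · rw [prod_density_eq hx' hxe, ENNReal.ofReal_lt_ofReal_iff (Real.exp_pos _),
      Real.exp_lt_exp] at hb
    refine ⟨_, natParam_mem hx' hxe, ?_⟩
    rw [hval]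
    linarith

/-- The exponent at the sample mean is the average of the exponents at the rewards, so it suffices
that the rewards, rather than their mean, lie in `F.X`. -/
lemma exists_tilt_le {x : ℝ} {s : Finset ℕ} (hs : s.Nonempty) {r : ℕ → ℝ}
    (hr : ∀ u ∈ s, r u ∈ F.X) :
    ∃ B, ∀ η ∈ F.paramSpace, F.tilt (F.natParam x) η ((∑ u ∈ s, r u) / s.card) ≤ B := by
  have hn : (0 : ℝ) < s.card := by exact_mod_cast hs.card_pos
  have : ∀ u, ∃ B, u ∈ s → ∀ η ∈ F.paramSpace, η * r u - F.logPartition η ≤ B := by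
    intro u
    by_cases hu : u ∈ s
    · obtain ⟨B, hB⟩ := exists_exponent_le (hr u hu)
      exact ⟨B, fun _ => hB⟩
    · exact ⟨0, fun h => absurd h hu⟩
  choose B hB using this
  refine ⟨(∑ u ∈ s, B u) / s.card - (F.natParam x * ((∑ u ∈ s, r u) / s.card)
    - F.logPartition (F.natParam x)), fun η hη => ?_⟩
  have h1 : ∑ u ∈ s, (η * r u - F.logPartition η) ≤ ∑ u ∈ s, B u :=
    Finset.sum_le_sum fun u hu => hB u hu η hη
  rw [Finset.sum_sub_distrib, ← Finset.mul_sum] at h1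
  simp only [Finset.sum_const, nsmul_eq_mul] at h1
  have h2 : η * ((∑ u ∈ s, r u) / s.card) - F.logPartition η ≤ (∑ u ∈ s, B u) / s.card := by
    rw [le_div_iff₀ hn]
    refine le_trans (le_of_eq ?_) h1
    field_simp
  rw [tilt]
  linarith

lemma iSup_prod_density_ne_top {s : Finset ℕ} {r : ℕ → ℝ} (hr : ∀ u ∈ s, r u ∈ F.X) :
    (⨆ x ∈ F.X, ∏ u ∈ s, F.density x (r u)) ≠ ⊤ := by
  have : ∀ u, ∃ B : ℝ≥0∞, u ∈ s → B ≠ ⊤ ∧ ∀ x ∈ F.X, F.density x (r u) ≤ B := by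
    intro u
    by_cases hu : u ∈ s
    · obtain ⟨B, hB⟩ := exists_density_le (hr u hu)
      exact ⟨B, fun _ => hB⟩
    · exact ⟨0, fun h => absurd h hu⟩
  choose B hB using this
  refine ne_top_of_le_ne_top (ENNReal.prod_ne_top fun u hu => (hB u hu).1)
    (iSup₂_le fun x hx => Finset.prod_le_prod' fun u hu => (hB u hu).2 x hx)

end ExpFamily

/-! ### Time slices, levels, and exponential moments of the deviation of one arm. -/

lemma tsum_slice_weights :
    ∑' p : ℕ × Bool, ENNReal.ofReal (3 / Real.pi ^ 2 / ((p.1 : ℝ) + 1) ^ 2) = 1 := by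
  -- The value `1 / 2` leaves room for the two parameters (the `Bool`) of each slice.
  have h1 : HasSum (fun i : ℕ => 3 / Real.pi ^ 2 / ((i : ℝ) + 1) ^ 2) (1 / 2) := by
    have h := (hasSum_nat_add_iff' 1).2 hasSum_zeta_two
    have h2 := h.mul_left (3 / Real.pi ^ 2)
    have hpi : Real.pi ≠ 0 := Real.pi_ne_zero
    have e1 : (fun i : ℕ => 3 / Real.pi ^ 2 / ((i : ℝ) + 1) ^ 2)
        = fun i : ℕ => 3 / Real.pi ^ 2 * (1 / ((i + 1 : ℕ) : ℝ) ^ 2) := by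
      ext i
      push_cast
      ring
    have e2 : (1 : ℝ) / 2
        = 3 / Real.pi ^ 2 * (Real.pi ^ 2 / 6 - ∑ i ∈ Finset.range 1, 1 / (i : ℝ) ^ 2) := by
      simp
      field_simp
      norm_num
    rw [e1, e2]
    exact h2
  rw [ENNReal.tsum_prod']
  simp only [tsum_bool, ← two_mul]
  rw [ENNReal.tsum_mul_left, ← ENNReal.ofReal_tsum_of_nonneg (fun i => by positivity) h1.summable,
    h1.tsum_eq]
  rw [show (2 : ℝ≥0∞) = ENNReal.ofReal 2 by simp, ← ENNReal.ofReal_mul (by norm_num)]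
  norm_num

/-- The normalised deviation of an arm drawn `n` times with maximal log-likelihood ratio `g`. -/
noncomputable def armDeviation (z g : ℝ) (n : ℕ) : ℝ :=
  (g - 3 * Real.log (1 + Real.log n)) / z
    - (Real.log (Real.pi ^ 2 / 3) - 2 * Real.log (Real.log z))

lemma log_pi_sq_div_three_pos : 0 < Real.log (Real.pi ^ 2 / 3) := by
  apply Real.log_pos
  have := Real.pi_gt_three
  nlinarith

/-- For a given level there is a mixture that is large whenever the deviation exceeds it. -/
lemma exists_mixture_level {F : ExpFamily} {x : ℝ} (hx : x ∈ F.X)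
    (hxe : ¬ IsExtremeAtom F.base x) {z : ℝ} (hz1 : 1 < z) (hz2 : z ≤ 3 / 2) {y ε : ℝ}
    (hy : 0 ≤ y) (hε : 0 < ε) :
    ∃ M, IsMixture (F.law x) 1 M ∧ ∀ (s : Finset ℕ) (r : ℕ → ℝ) (g : ℝ), s.Nonempty →
      (∀ u ∈ s, r u ∈ F.X) → ENNReal.ofReal (Real.exp g) ≤ armRatio F x s r →
      y ≤ armDeviation z g s.card → ENNReal.ofReal (Real.exp (y - ε)) ≤ M s r := by
  have hz0 : 0 < z := by linarith
  have hlogz : 0 < Real.log z := Real.log_pos hz1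
  have hlogz1 : Real.log z ≤ 1 := by
    have := Real.log_le_sub_one_of_pos hz0
    linarith
  -- The slice costs a factor `z`; after division by it, `y` plus the log of the inverse weight `π²
  -- (i + 1)² / 3` remains.
  set lev : ℕ → ℝ := fun i => z * (y + Real.log (Real.pi ^ 2 / 3) + 2 * Real.log ((i : ℝ) + 1))
    with hlev
  have hlevpos : ∀ i, 0 < lev i := by
    intro i
    have h1 : 0 ≤ Real.log ((i : ℝ) + 1) := Real.log_nonneg (by simp)
    have := log_pi_sq_div_three_pos
    exact mul_pos hz0 (by linarith)
  -- On slice `i` one has `n ≤ z ^ (i + 1)`, so the level per draw is at least `lev i / z ^ (i +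
  -- 1)`, and a loss of `ε / z ^ (i + 1)` per draw adds up to at most `ε`.
  have hex := fun i : ℕ => ExpFamily.exists_uniform_param (F := F) hx hxe
    (div_pos (hlevpos i) (pow_pos hz0 (i + 1))) (div_pos hε (pow_pos hz0 (i + 1)))
  choose η hη H using hex
  set η₀ := F.natParam x with hη₀
  have hmix := IsMixture.tsum (ν := F.law x) (ι := ℕ × Bool) (C := fun _ => 1)
      (M := fun p s r => ∏ u ∈ s, ENNReal.ofReal (Real.exp (F.tilt η₀ (η p.1 p.2) (r u))))
      (fun p => ENNReal.ofReal (3 / Real.pi ^ 2 / ((p.1 : ℝ) + 1) ^ 2)) (fun p =>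
        IsMixture.prod (q := fun v => ENNReal.ofReal (Real.exp (F.tilt η₀ (η p.1 p.2) v)))
          (by unfold ExpFamily.tilt; fun_prop)
          (ExpFamily.lintegral_law_ratio hx hxe (hη p.1 p.2)).le)
  simp only [mul_one, tsum_slice_weights] at hmix
  refine ⟨_, hmix, ?_⟩
  intro s r g hs hr hg hyle
  have hn1 : (1 : ℝ) ≤ s.card := by exact_mod_cast hs.card_pos
  have hn : (0 : ℝ) < s.card := by linarith
  set N : ℝ := (s.card : ℝ) with hN
  have hlogn : 0 ≤ Real.log N := Real.log_nonneg hn1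
  set i := ⌊Real.log N / Real.log z⌋₊ with hi
  have hi1 : (i : ℝ) * Real.log z ≤ Real.log N := by
    rw [← le_div_iff₀ hlogz]
    exact Nat.floor_le (by positivity)
  have hi2 : Real.log N < ((i : ℝ) + 1) * Real.log z := by
    rw [← div_lt_iff₀ hlogz]
    exact Nat.lt_floor_add_one _
  have hlow : z ^ i ≤ N := by
    rw [← Real.log_le_log_iff (by positivity) hn, Real.log_pow]
    exact hi1
  have hup : N ≤ z ^ (i + 1) := by
    rw [← Real.log_le_log_iff hn (by positivity), Real.log_pow]
    push_cast
    exact hi2.le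
  have hlogi : Real.log ((i : ℝ) + 1) ≤ Real.log (1 + Real.log N) - Real.log (Real.log z) := by
    rw [← Real.log_div (by positivity) hlogz.ne']
    refine Real.log_le_log (by positivity) ?_
    rw [le_div_iff₀ hlogz]
    nlinarith
  have hlogn1 : 0 ≤ Real.log (1 + Real.log N) := Real.log_nonneg (by linarith)
  have hlg : lev i ≤ g := by
    rw [armDeviation, ← hN] at hyle
    have h1 : y + (Real.log (Real.pi ^ 2 / 3) - 2 * Real.log (Real.log z))
        ≤ (g - 3 * Real.log (1 + Real.log N)) / z := by linarith
    rw [le_div_iff₀ hz0] at h1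
    simp only [hlev]
    -- The coefficient 3 in the threshold comes from here: `2 z ≤ 3`.
    nlinarith [mul_le_mul_of_nonneg_left hlogi hz0.le,
      mul_nonneg (sub_nonneg.2 hz2) hlogn1]
  have hdiv : lev i / z ^ (i + 1) * N ≤ lev i := by
    rw [div_mul_eq_mul_div, div_le_iff₀ (by positivity)]
    exact mul_le_mul_of_nonneg_left hup (hlevpos i).le
  obtain ⟨j, hj⟩ := H i ((∑ u ∈ s, r u) / s.card) (ExpFamily.exists_tilt_le hs hr) (by
    intro b hb
    have hb' : b * N < g := by
      have := mul_lt_mul_of_pos_right hb hn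
      linarith
    obtain ⟨η', hη', hlt⟩ := ExpFamily.exists_lt_tilt hx hxe hs (r := r) (b := b * N)
      (lt_of_lt_of_le ((ENNReal.ofReal_lt_ofReal_iff (Real.exp_pos _)).2
        (Real.exp_lt_exp.2 hb')) hg)
    refine ⟨η', hη', ?_⟩
    rw [mul_comm b] at hlt
    exact lt_of_mul_lt_mul_left hlt hn.le)
  refine le_trans ?_ (ENNReal.le_tsum (i, j))
  simp only
  rw [ExpFamily.prod_tilt F _ _ s hs, ← ENNReal.ofReal_mul (by positivity)]
  refine ENNReal.ofReal_le_ofReal ?_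
  have hexp : y - ε + Real.log (Real.pi ^ 2 / 3) + 2 * Real.log ((i : ℝ) + 1)
      ≤ N * F.tilt η₀ (η i j) ((∑ u ∈ s, r u) / s.card) := by
    have h1 := mul_le_mul_of_nonneg_left hj hn.le
    have h2 : N * (ε / z ^ (i + 1)) ≤ ε := by
      rw [mul_div_assoc', div_le_iff₀ (by positivity), mul_comm]
      exact mul_le_mul_of_nonneg_left hup hε.le
    -- Uses the lower end of the slice, `z ^ i ≤ N`.
    have h3 : lev i / z ≤ N * (lev i / z ^ (i + 1)) := by
      rw [mul_div_assoc', div_le_div_iff₀ hz0 (by positivity), pow_succ]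
      nlinarith [mul_le_mul_of_nonneg_left hlow (mul_pos (hlevpos i) hz0).le]
    have h4 : lev i / z = y + Real.log (Real.pi ^ 2 / 3) + 2 * Real.log ((i : ℝ) + 1) := by
      simp only [hlev]
      field_simp
    linarith
  have h5 := Real.exp_le_exp.2 hexp
  have hi0 : (0 : ℝ) < (i : ℝ) + 1 := by positivity
  rw [Real.exp_add, Real.exp_add, Real.exp_log (by positivity), two_mul (Real.log _),
    Real.exp_add, Real.exp_log hi0] at h5
  calc Real.exp (y - ε) = 3 / Real.pi ^ 2 / ((i : ℝ) + 1) ^ 2 *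
        (Real.exp (y - ε) * (Real.pi ^ 2 / 3) * (((i : ℝ) + 1) * ((i : ℝ) + 1))) := by
          have := Real.pi_ne_zero
          field_simp
    _ ≤ _ := mul_le_mul_of_nonneg_left h5 (by positivity)

/-- Total mass of the mixture that dominates `exp (l * Y)` when the levels are `ε` apart. -/
noncomputable def mixtureMass (l ε : ℝ) : ℝ :=
  1 + Real.exp ε * (Real.exp (l * ε) - 1) / (1 - Real.exp (-((1 - l) * ε)))

/-- A geometric series of ratio `exp (-(1 - l) ε)`, discretising the integral of `l exp (l y) exp
(-y)` over `y ≥ 0`. -/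
lemma hasSum_level_weights {l ε : ℝ} (hl1 : l < 1) (hε : 0 < ε) :
    HasSum (fun k : ℕ => (Real.exp (l * ((k + 1) * ε)) - Real.exp (l * (k * ε))) *
      Real.exp (-(k * ε - ε)))
      (Real.exp ε * (Real.exp (l * ε) - 1) / (1 - Real.exp (-((1 - l) * ε)))) := by
  have h := (hasSum_geometric_of_lt_one (Real.exp_pos (-((1 - l) * ε))).le
    (Real.exp_lt_one_iff.2 (by nlinarith))).mul_left (Real.exp ε * (Real.exp (l * ε) - 1))
  rw [← div_eq_mul_inv] at h
  rw [show (fun k : ℕ => (Real.exp (l * ((k + 1) * ε)) - Real.exp (l * (k * ε))) *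
      Real.exp (-(k * ε - ε))) = fun k : ℕ => Real.exp ε * (Real.exp (l * ε) - 1)
        * Real.exp (-((1 - l) * ε)) ^ k from ?_]
  · exact h
  ext k
  rw [← Real.exp_nat_mul, sub_mul, mul_sub, sub_mul, mul_one]
  simp only [← Real.exp_add]
  congr 2 <;> ring

/-- After dividing numerator and denominator by `ε`, both are difference quotients at zero, and the
limit is `1 + l / (1 - l)`. -/
lemma tendsto_mixtureMass {l : ℝ} (hl1 : l < 1) :
    Tendsto (mixtureMass l) (𝓝[>] 0) (𝓝 (1 / (1 - l))) := by
  have h1 : Tendsto (fun ε : ℝ => (Real.exp (l * ε) - 1) / ε) (𝓝[>] 0) (𝓝 l) := by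
    have : HasDerivAt (fun ε : ℝ => Real.exp (l * ε)) l 0 := by
      simpa using ((hasDerivAt_id (0 : ℝ)).const_mul l).exp
    have := this.tendsto_slope_zero_right
    simpa [div_eq_inv_mul] using this
  have h2 : Tendsto (fun ε : ℝ => (1 - Real.exp (-((1 - l) * ε))) / ε) (𝓝[>] 0)
      (𝓝 (1 - l)) := by
    have : HasDerivAt (fun ε : ℝ => -Real.exp (-((1 - l) * ε))) (1 - l) 0 := by
      simpa using! ((((hasDerivAt_id (0 : ℝ)).const_mul (1 - l)).neg).exp).neg
    have := this.tendsto_slope_zero_right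
    simp only [zero_add, mul_zero, neg_zero, Real.exp_zero, smul_eq_mul] at this
    refine this.congr fun ε => ?_
    ring
  have h3 : Tendsto (fun ε : ℝ => Real.exp ε) (𝓝[>] 0) (𝓝 1) := by
    have := Real.continuous_exp.tendsto 0
    rw [Real.exp_zero] at this
    exact this.mono_left nhdsWithin_le_nhds
  have h4 := (h3.mul (h1.div h2 (by linarith))).const_add 1
  have h5 : 1 + 1 * (l / (1 - l)) = 1 / (1 - l) := by
    have : 1 - l ≠ 0 := by linarith
    field_simp
    ring
  rw [h5] at h4
  refine h4.congr' ?_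
  filter_upwards [self_mem_nhdsWithin] with ε hε
  have hε' : ε ≠ 0 := ne_of_gt hε
  simp only [Pi.div_apply, mixtureMass]
  rw [div_div_div_cancel_right₀ hε', mul_div_assoc]

lemma one_le_mixtureMass {l ε : ℝ} (hl0 : 0 ≤ l) (hl1 : l < 1) (hε : 0 < ε) :
    1 ≤ mixtureMass l ε := by
  have h1 : 1 ≤ Real.exp (l * ε) := Real.one_le_exp (by positivity)
  have h2 : Real.exp (-((1 - l) * ε)) < 1 := Real.exp_lt_one_iff.2 (by nlinarith)
  have : 0 ≤ Real.exp ε * (Real.exp (l * ε) - 1) / (1 - Real.exp (-((1 - l) * ε))) :=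
    div_nonneg (mul_nonneg (Real.exp_pos _).le (by linarith)) (by linarith)
  rw [mixtureMass]
  linarith

/-- Exponential moments of the deviation of an arm are dominated by a mixture. -/
lemma exists_mixture_exp {F : ExpFamily} {x : ℝ} (hx : x ∈ F.X)
    (hxe : ¬ IsExtremeAtom F.base x) {z : ℝ} (hz1 : 1 < z) (hz2 : z ≤ 3 / 2) {l ε : ℝ}
    (hl0 : 0 ≤ l) (hl1 : l < 1) (hε : 0 < ε) :
    ∃ M, IsMixture (F.law x) (ENNReal.ofReal (mixtureMass l ε)) M ∧
      ∀ (s : Finset ℕ) (r : ℕ → ℝ) (g : ℝ), s.Nonempty →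
        (∀ u ∈ s, r u ∈ F.X) → ENNReal.ofReal (Real.exp g) ≤ armRatio F x s r →
        ENNReal.ofReal (Real.exp (l * armDeviation z g s.card)) ≤ M s r := by
  have := ExpFamily.isProbabilityMeasure_law hx
  have hex := fun k : ℕ => exists_mixture_level hx hxe hz1 hz2 (y := k * ε) (by positivity) hε
  choose M hM hMle using hex
  -- The jump of `exp (l ·)` across a grid cell, times the factor that makes `d k * M k` at least
  -- that jump once `Y ≥ k ε`. The jumps telescope to a bound on `exp (l * Y)`; the constant 1
  -- covers `Y < 0`.
  set d : ℕ → ℝ := fun k => (Real.exp (l * ((k + 1) * ε)) - Real.exp (l * (k * ε))) *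
      Real.exp (-(k * ε - ε)) with hd
  have hdiff : ∀ k : ℕ, 0 ≤ Real.exp (l * ((k + 1) * ε)) - Real.exp (l * (k * ε)) := by
    intro k
    rw [sub_nonneg, Real.exp_le_exp]
    gcongr
    linarith
  have hd0 : ∀ k, 0 ≤ d k := fun k => mul_nonneg (hdiff k) (Real.exp_pos _).le
  have hsum := hasSum_level_weights hl1 hε
  have h := (IsMixture.const (ν := F.law x) 1).add
      (IsMixture.tsum (fun k => ENNReal.ofReal (d k)) hM)
  simp only [mul_one] at h
  rw [← ENNReal.ofReal_tsum_of_nonneg hd0 hsum.summable, hsum.tsum_eq, ← ENNReal.ofReal_one,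
      ← ENNReal.ofReal_add zero_le_one (by
        have := one_le_mixtureMass hl0 hl1 hε
        rw [mixtureMass] at this
        linarith)] at h
  refine ⟨_, h, ?_⟩
  intro s r g hs hr hg
  set Y := armDeviation z g s.card with hY
  rcases lt_or_ge Y 0 with hneg | hpos
  · refine le_trans ?_ le_self_add
    refine ENNReal.ofReal_le_ofReal (Real.exp_le_one_iff.2 ?_)
    nlinarith
  · set j := ⌊Y / ε⌋₊ with hj
    have hj1 : (j : ℝ) * ε ≤ Y := by
      rw [← le_div_iff₀ hε]
      exact Nat.floor_le (by positivity)
    have hj2 : Y < ((j : ℝ) + 1) * ε := by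
      rw [← div_lt_iff₀ hε]
      exact Nat.lt_floor_add_one _
    have hterm : ∀ k ∈ Finset.range (j + 1), ENNReal.ofReal
        (Real.exp (l * ((k + 1) * ε)) - Real.exp (l * (k * ε)))
        ≤ ENNReal.ofReal (d k) * M k s r := by
      intro k hk
      have hkj : (k : ℝ) ≤ j := by
        exact_mod_cast Nat.lt_succ_iff.1 (Finset.mem_range.1 hk)
      have h1 := hMle k s r g hs hr hg ((mul_le_mul_of_nonneg_right hkj hε.le).trans hj1)
      calc _ = ENNReal.ofReal (d k) * ENNReal.ofReal (Real.exp (k * ε - ε)) := by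
            rw [← ENNReal.ofReal_mul (hd0 k), hd]
            simp only
            rw [mul_assoc, ← Real.exp_add]
            simp
        _ ≤ _ := by gcongr
    have htel : ∑ k ∈ Finset.range (j + 1),
        (Real.exp (l * (((k : ℝ) + 1) * ε)) - Real.exp (l * (k * ε)))
        = Real.exp (l * (((j : ℝ) + 1) * ε)) - 1 := by
      have := Finset.sum_range_sub (fun k : ℕ => Real.exp (l * ((k : ℝ) * ε))) (j + 1)
      push_cast at this
      simpa using this
    calc ENNReal.ofReal (Real.exp (l * Y))
        ≤ ENNReal.ofReal (1 + ∑ k ∈ Finset.range (j + 1),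
          (Real.exp (l * (((k : ℝ) + 1) * ε)) - Real.exp (l * (k * ε)))) := by
          rw [htel, add_sub_cancel]
          refine ENNReal.ofReal_le_ofReal (Real.exp_le_exp.2 ?_)
          exact mul_le_mul_of_nonneg_left hj2.le hl0
      _ = 1 + ∑ k ∈ Finset.range (j + 1), ENNReal.ofReal
          (Real.exp (l * (((k : ℝ) + 1) * ε)) - Real.exp (l * (k * ε))) := by
          rw [ENNReal.ofReal_add zero_le_one (Finset.sum_nonneg fun k _ => hdiff k),
            ENNReal.ofReal_sum_of_nonneg fun k _ => hdiff k, ENNReal.ofReal_one]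
      _ ≤ 1 + ∑ k ∈ Finset.range (j + 1), ENNReal.ofReal (d k) * M k s r := by
          gcongr with k hk
          exact hterm k hk
      _ ≤ _ := by
          rw [ENNReal.ofReal_one]
          gcongr
          exact ENNReal.sum_le_tsum _

/-! ### Ville's inequality. -/

section Ville

variable {Ω : Type*} [MeasurableSpace Ω] {P : Measure Ω}
  {ℱ : Filtration ℕ (inferInstance : MeasurableSpace Ω)}

/-- Ville's inequality for a process with values in `ℝ≥0∞`. -/
theorem mul_measure_exists_le_le_lintegral {W : ℕ → Ω → ℝ≥0∞}
    (hW : ∀ t, Measurable[ℱ t] (W t))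
    (hstep : ∀ t A, MeasurableSet[ℱ t] A → ∫⁻ ω in A, W (t + 1) ω ∂P ≤ ∫⁻ ω in A, W t ω ∂P)
    (c : ℝ≥0∞) : c * P {ω | ∃ t, c ≤ W t ω} ≤ ∫⁻ ω, W 0 ω ∂P := by
  set B : ℕ → Set Ω := fun t => {ω | ∀ s ≤ t, W s ω < c} with hB
  have hBs : ∀ t, B (t + 1) = B t ∩ {ω | W (t + 1) ω < c} := by
    intro t
    ext ω
    simp only [hB, mem_ofPred_eq, mem_inter_iff]
    constructor
    · exact fun h => ⟨fun s hs => h s (hs.trans t.le_succ), h _ le_rfl⟩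
    · rintro ⟨h1, h2⟩ s hs
      rcases Nat.le_succ_iff.1 hs with hs | rfl
      exacts [h1 s hs, h2]
  have hBm : ∀ t, MeasurableSet[ℱ t] (B t) := by
    intro t
    induction t with
    | zero =>
      have : B 0 = {ω | W 0 ω < c} := by
        ext ω
        simp [hB]
      rw [this]
      exact @measurableSet_lt _ _ _ _ _ (ℱ 0) _ _ _ _ _ (hW 0) measurable_const
    | succ t ih =>
      rw [hBs]
      exact (ℱ.mono t.le_succ _ ih).inter
        (@measurableSet_lt _ _ _ _ _ (ℱ (t + 1)) _ _ _ _ _ (hW _) measurable_const)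
  have hBm' : ∀ t, MeasurableSet (B t) := fun t => ℱ.le t _ (hBm t)
  have hWm : ∀ t, Measurable (W t) := fun t => (hW t).mono (ℱ.le t) le_rfl
  have hmarkov : ∀ (S : Set Ω) t, MeasurableSet S → (∀ ω ∈ S, c ≤ W t ω) →
      c * P S ≤ ∫⁻ ω in S, W t ω ∂P := by
    intro S t hS h
    rw [← setLIntegral_const]
    exact setLIntegral_mono (hWm t) h
  -- Charge `c` for every path that has crossed and the current value for the others: the total
  -- never exceeds the initial integral.
  have key : ∀ t, c * P (B t)ᶜ + ∫⁻ ω in B t, W t ω ∂P ≤ ∫⁻ ω, W 0 ω ∂P := by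
    intro t
    induction t with
    | zero =>
      rw [← lintegral_add_compl (μ := P) (W 0) (hBm' 0), add_comm]
      gcongr
      refine hmarkov _ 0 (hBm' 0).compl fun ω hω => ?_
      by_contra! hlt
      exact hω (by
        simp only [hB, mem_ofPred_eq, Nat.le_zero]
        rintro s rfl
        exact hlt)
    | succ t ih =>
      have hlt : MeasurableSet {ω | W (t + 1) ω < c} :=
        measurableSet_lt (hWm _) measurable_const
      have h1 : (B (t + 1))ᶜ ⊆ (B t)ᶜ ∪ (B t \ {ω | W (t + 1) ω < c}) := by
        rw [hBs]
        intro ω hω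
        by_cases hb : ω ∈ B t
        · exact Or.inr ⟨hb, fun h => hω ⟨hb, h⟩⟩
        · exact Or.inl hb
      calc c * P (B (t + 1))ᶜ + ∫⁻ ω in B (t + 1), W (t + 1) ω ∂P
          ≤ c * (P (B t)ᶜ + P (B t \ {ω | W (t + 1) ω < c}))
            + ∫⁻ ω in B (t + 1), W (t + 1) ω ∂P := by
            gcongr
            exact (measure_mono h1).trans (measure_union_le _ _)
        _ ≤ c * P (B t)ᶜ + (∫⁻ ω in B t ∩ {ω | W (t + 1) ω < c}, W (t + 1) ω ∂P
            + ∫⁻ ω in B t \ {ω | W (t + 1) ω < c}, W (t + 1) ω ∂P) := by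
            rw [mul_add, add_assoc, add_comm (c * P (B t \ _)), hBs]
            gcongr
            exact hmarkov _ _ ((hBm' t).diff hlt) fun ω hω => not_lt.1 hω.2
        _ = c * P (B t)ᶜ + ∫⁻ ω in B t, W (t + 1) ω ∂P := by
            rw [lintegral_inter_add_sdiff _ _ hlt]
        _ ≤ _ := by
            refine le_trans ?_ ih
            exact add_le_add le_rfl (hstep t _ (hBm t))
  have hmono : Monotone fun t => (B t)ᶜ := by
    refine monotone_nat_of_le_succ fun t => compl_subset_compl.2 ?_
    rw [hBs]
    exact inter_subset_left
  have hU : {ω | ∃ t, c ≤ W t ω} ⊆ ⋃ t, (B t)ᶜ := by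
    rintro ω ⟨t, ht⟩
    exact mem_iUnion.2 ⟨t, fun h => (h t le_rfl).not_ge ht⟩
  calc c * P {ω | ∃ t, c ≤ W t ω} ≤ c * P (⋃ t, (B t)ᶜ) := by gcongr
    _ = ⨆ t, c * P (B t)ᶜ := by rw [hmono.measure_iUnion, ENNReal.mul_iSup]
    _ ≤ _ := iSup_le fun t => le_self_add.trans (key t)

end Ville

/-! ### Adaptive sampling and the product supermartingale. -/

lemma drawRounds_zero {L : Type} [DecidableEq L] (I : ℕ → L) (l : L) : drawRounds I 0 l = ∅ := by
  simp [drawRounds]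

lemma drawRounds_succ_self {L : Type} [DecidableEq L] (I : ℕ → L) (t : ℕ) :
    drawRounds I (t + 1) (I (t + 1)) = insert (t + 1) (drawRounds I t (I (t + 1))) := by
  ext u
  simp only [drawRounds, Finset.mem_filter, Finset.mem_Icc, Finset.mem_insert]
  constructor
  · rintro ⟨⟨h1, h2⟩, h3⟩
    rcases Nat.le_succ_iff.1 h2 with h | h
    exacts [Or.inr ⟨⟨h1, h⟩, h3⟩, Or.inl h]
  · rintro (rfl | ⟨⟨h1, h2⟩, h3⟩)
    exacts [⟨⟨by omega, le_rfl⟩, rfl⟩, ⟨⟨h1, by omega⟩, h3⟩]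

lemma drawRounds_succ_of_ne {L : Type} [DecidableEq L] {I : ℕ → L} {t : ℕ} {l : L}
    (h : I (t + 1) ≠ l) : drawRounds I (t + 1) l = drawRounds I t l := by
  ext u
  simp only [drawRounds, Finset.mem_filter, Finset.mem_Icc]
  constructor
  · rintro ⟨⟨h1, h2⟩, h3⟩
    rcases Nat.le_succ_iff.1 h2 with h' | rfl
    exacts [⟨⟨h1, h'⟩, h3⟩, absurd h3 h]
  · rintro ⟨⟨h1, h2⟩, h3⟩
    exact ⟨⟨h1, by omega⟩, h3⟩

lemma drawRounds_mono {L : Type} [DecidableEq L] (I : ℕ → L) {t t' : ℕ} (h : t ≤ t') (l : L) :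
    drawRounds I t l ⊆ drawRounds I t' l := by
  intro u
  simp only [drawRounds, Finset.mem_filter, Finset.mem_Icc]
  rintro ⟨⟨h1, h2⟩, h3⟩
  exact ⟨⟨h1, h2.trans h⟩, h3⟩

namespace IsSamplingProcess

variable {Ω : Type*} [MeasurableSpace Ω] {P : Measure Ω} [IsProbabilityMeasure P]
  {ℱ : Filtration ℕ (inferInstance : MeasurableSpace Ω)} {F : ExpFamily} {L : Type}
  {μ : L → ℝ} {I : ℕ → Ω → L} {r : ℕ → Ω → ℝ}

lemma measure_inter_reward (h : IsSamplingProcess P ℱ F μ I r) (hμ : ∀ l, μ l ∈ F.X) {t : ℕ}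
    {l : L} {A : Set Ω} (hA : MeasurableSet[ℱ t] A) {B : Set ℝ} (hB : MeasurableSet B) :
    P (A ∩ {ω | I (t + 1) ω = l} ∩ r (t + 1) ⁻¹' B)
      = P (A ∩ {ω | I (t + 1) ω = l}) * F.law (μ l) B := by
  have := ExpFamily.isProbabilityMeasure_law (hμ l)
  set S := A ∩ {ω | I (t + 1) ω = l} with hS
  have hSm : MeasurableSet[ℱ t] S := hA.inter (h.predictable t l)
  have hSm' : MeasurableSet S := ℱ.le t _ hSm
  have hrB : MeasurableSet (r (t + 1) ⁻¹' B) :=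
    ((h.adapted t).mono (ℱ.le _) le_rfl) hB
  have h1 : ∫ ω in S, (P⟦r (t + 1) ⁻¹' B | ℱ t⟧) ω ∂P = P.real (S ∩ r (t + 1) ⁻¹' B) := by
    rw [setIntegral_condExp (ℱ.le t) ((integrable_const (1 : ℝ)).indicator hrB) hSm,
      setIntegral_indicator hrB, setIntegral_const]
    simp
  have h2 : ∫ ω in S, (P⟦r (t + 1) ⁻¹' B | ℱ t⟧) ω ∂P = P.real S * (F.law (μ l)).real B := by
    rw [setIntegral_congr_ae (g := fun _ => (F.law (μ l)).real B) hSm' (by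
      filter_upwards [h.reward_law t B hB] with ω hω hωS
      rw [hω]
      have : I (t + 1) ω = l := hωS.2
      rw [this]), setIntegral_const]
    simp
  rw [h1] at h2
  rw [← ENNReal.toReal_eq_toReal_iff' (measure_ne_top _ _)
    (ENNReal.mul_ne_top (measure_ne_top _ _) (measure_ne_top _ _)), ENNReal.toReal_mul]
  exact h2

/-- The two sides come from measures `ν₁`, `ν₂` that agree on `ℱ t` by `measure_inter_reward`; hence
they integrate the `ℱ t`-measurable `G` equally. -/
lemma setLIntegral_mul_reward (h : IsSamplingProcess P ℱ F μ I r) (hμ : ∀ l, μ l ∈ F.X) {t : ℕ}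
    {l : L} {G : Ω → ℝ≥0∞} (hG : Measurable[ℱ t] G) {q : ℝ → ℝ≥0∞} (hq : Measurable q) :
    ∫⁻ ω in {ω | I (t + 1) ω = l}, G ω * q (r (t + 1) ω) ∂P
      = (∫⁻ ω in {ω | I (t + 1) ω = l}, G ω ∂P) * ∫⁻ y, q y ∂(F.law (μ l)) := by
  have hr : Measurable (r (t + 1)) := (h.adapted t).mono (ℱ.le _) le_rfl
  have hG' : Measurable G := hG.mono (ℱ.le t) le_rfl
  set S : Set Ω := {ω | I (t + 1) ω = l} with hS
  have hSm : MeasurableSet S := ℱ.le t _ (h.predictable t l)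
  have hset : ∀ A, MeasurableSet[ℱ t] A →
      ∫⁻ ω in A ∩ S, q (r (t + 1) ω) ∂P = P (A ∩ S) * ∫⁻ y, q y ∂(F.law (μ l)) := by
    intro A hA
    have hmap : (P.restrict (A ∩ S)).map (r (t + 1)) = P (A ∩ S) • F.law (μ l) := by
      ext B hB
      rw [Measure.map_apply hr hB, Measure.restrict_apply (hr hB), inter_comm,
        h.measure_inter_reward hμ hA hB]
      simp [hS]
    rw [← lintegral_map hq hr, hmap, lintegral_smul_measure, smul_eq_mul]
  set ν₁ := (P.restrict S).withDensity fun ω => q (r (t + 1) ω) with hν₁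
  set ν₂ := (∫⁻ y, q y ∂(F.law (μ l))) • P.restrict S with hν₂
  have htrim : ν₁.trim (ℱ.le t) = ν₂.trim (ℱ.le t) := by
    refine @Measure.ext _ (ℱ t) _ _ fun A hA => ?_
    have hA' := ℱ.le t _ hA
    rw [trim_measurableSet_eq _ hA, trim_measurableSet_eq _ hA, hν₁, hν₂,
      withDensity_apply _ hA', Measure.restrict_restrict hA', hset A hA, Measure.smul_apply,
      Measure.restrict_apply hA', smul_eq_mul, mul_comm]
  have h1 : ∫⁻ ω, G ω ∂ν₁ = ∫⁻ ω, G ω ∂ν₂ := by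
    rw [← lintegral_trim (ℱ.le t) hG, htrim, lintegral_trim (ℱ.le t) hG]
  rw [hν₁, hν₂, lintegral_withDensity_eq_lintegral_mul _ (by fun_prop) hG',
    lintegral_smul_measure, smul_eq_mul, mul_comm (lintegral _ _)] at h1
  rw [← h1]
  refine lintegral_congr fun ω => ?_
  simp [mul_comm]

/-- Almost surely, all rewards lie in given sets that have full measure for the laws of the
arms. -/
lemma ae_reward_mem [Finite L] (h : IsSamplingProcess P ℱ F μ I r) (hμ : ∀ l, μ l ∈ F.X)
    {R : L → Set ℝ} (hR : ∀ l, MeasurableSet (R l)) (hR0 : ∀ l, F.law (μ l) (R l)ᶜ = 0) :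
    ∀ᵐ ω ∂P, ∀ t, r (t + 1) ω ∈ R (I (t + 1) ω) := by
  rw [ae_all_iff]
  intro t
  have : ∀ᵐ ω ∂P, ∀ l, ¬ (ω ∈ univ ∩ {ω | I (t + 1) ω = l} ∩ r (t + 1) ⁻¹' (R l)ᶜ) := by
    rw [ae_all_iff]
    intro l
    refine measure_eq_zero_iff_ae_notMem.1 ?_
    rw [h.measure_inter_reward hμ MeasurableSet.univ (hR l).compl, hR0, mul_zero]
  filter_upwards [this] with ω hω
  have := hω (I (t + 1) ω)
  simpa using this

lemma measurable_prod_drawRounds [DecidableEq L] (h : IsSamplingProcess P ℱ F μ I r) {q : ℝ → ℝ≥0∞}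
    (hq : Measurable q) (t : ℕ) (l : L) :
    Measurable[ℱ t] fun ω => ∏ u ∈ drawRounds (fun u => I u ω) t l, q (r u ω) := by
  simp only [drawRounds, Finset.prod_filter]
  refine Finset.measurable_fun_prod (m := ℱ t) _ fun u hu => ?_
  obtain ⟨v, rfl⟩ := Nat.exists_eq_add_of_le' (Finset.mem_Icc.1 hu).1
  have hvt := (Finset.mem_Icc.1 hu).2
  refine Measurable.ite (ℱ.mono (by omega) _ (h.predictable v l))
    (hq.comp ((h.adapted v).mono (ℱ.mono hvt) le_rfl)) measurable_const

/-- A product over the arms of mixtures satisfies Ville's inequality. -/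
theorem mul_measure_exists_le_prod [Fintype L] [DecidableEq L]
    (h : IsSamplingProcess P ℱ F μ I r) (hμ : ∀ l, μ l ∈ F.X)
    {C : L → ℝ≥0∞} {M : L → Finset ℕ → (ℕ → ℝ) → ℝ≥0∞}
    (hM : ∀ l, IsMixture (F.law (μ l)) (C l) (M l)) (a : ℝ≥0∞) :
    a * P {ω | ∃ t, a ≤ ∏ l, M l (drawRounds (fun u => I u ω) t l) fun u => r u ω}
      ≤ ∏ l, C l := by
  choose κ hκ c q hq hq1 hc hM using hM
  set D : ℕ → L → Ω → Finset ℕ := fun t l ω => drawRounds (fun u => I u ω) t l with hD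
  set W : ℕ → Ω → ℝ≥0∞ := fun t ω => ∏ l, M l (D t l ω) fun u => r u ω with hWdef
  have hMm : ∀ t l, Measurable[ℱ t] fun ω => M l (D t l ω) fun u => r u ω := by
    intro t l
    simp only [hM]
    refine @Measurable.tsum _ _ _ (ℱ t) _ _ _ _ _ _ _ _ _ _ _ _ fun k => ?_
    exact (h.measurable_prod_drawRounds (hq l k) t l).const_mul (m := ℱ t) _
  refine (mul_measure_exists_le_le_lintegral (ℱ := ℱ) (W := W) (fun t => ?_) ?_ a).trans ?_
  · exact Finset.measurable_fun_prod (m := ℱ t) _ fun l _ => hMm t l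
  · intro t A hA
    have hpart : ∀ f : Ω → ℝ≥0∞, ∫⁻ ω in A, f ω ∂P
        = ∑ l, ∫⁻ ω in {ω | I (t + 1) ω = l}, A.indicator f ω ∂P := by
      intro f
      rw [← lintegral_indicator (ℱ.le t _ hA), ← setLIntegral_univ,
        show (univ : Set Ω) = ⋃ l, {ω | I (t + 1) ω = l} by ext; simp,
        lintegral_iUnion (fun l => ℱ.le t _ (h.predictable t l)) (fun l l' hll => by
          refine Set.disjoint_left.2 fun ω hω hω' => hll ?_
          exact hω.symm.trans hω'), tsum_fintype]
    rw [hpart, hpart]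
    refine Finset.sum_le_sum fun l _ => ?_
    set S : Set Ω := {ω | I (t + 1) ω = l} with hS
    have hSm : MeasurableSet S := ℱ.le t _ (h.predictable t l)
    -- If arm `l` is drawn, the `k`-th term of its mixture gains the factor `q l k` of the new
    -- reward, and all other arms are frozen. Mixtures are therefore handled term by term.
    set G : κ l → Ω → ℝ≥0∞ := fun k => A.indicator fun ω =>
      (∏ l' ∈ Finset.univ.erase l, M l' (D t l' ω) fun u => r u ω) *
        (c l k * ∏ u ∈ D t l ω, q l k (r u ω)) with hG
    have hGm : ∀ k, Measurable[ℱ t] (G k) := by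
      intro k
      refine Measurable.indicator (m := ℱ t) (Measurable.mul (m := ℱ t) ?_ ?_) hA
      · exact Finset.measurable_fun_prod (m := ℱ t) _ fun l' _ => hMm t l'
      · exact (h.measurable_prod_drawRounds (hq l k) t l).const_mul (m := ℱ t) _
    have hGm' : ∀ k, Measurable (G k) := fun k => (hGm k).mono (ℱ.le t) le_rfl
    have hr : Measurable (r (t + 1)) := (h.adapted t).mono (ℱ.le _) le_rfl
    have e1 : ∀ ω ∈ S, A.indicator (W (t + 1)) ω = ∑' k, G k ω * q l k (r (t + 1) ω) := by
      intro ω hω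
      have hω' : I (t + 1) ω = l := hω
      by_cases hωA : ω ∈ A
      · simp only [hG, Set.indicator_of_mem hωA, hWdef]
        rw [← Finset.mul_prod_erase _ _ (Finset.mem_univ l), hM, mul_comm,
          ← ENNReal.tsum_mul_left]
        have hd : D (t + 1) l ω = insert (t + 1) (D t l ω) := by
          rw [← hω']
          exact drawRounds_succ_self (fun u => I u ω) t
        have hnot : t + 1 ∉ D t l ω := by
          simp [hD, drawRounds]
        refine tsum_congr fun k => ?_
        rw [hd, Finset.prod_insert hnot]
        have : ∏ l' ∈ Finset.univ.erase l, M l' (D (t + 1) l' ω) (fun u => r u ω)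
            = ∏ l' ∈ Finset.univ.erase l, M l' (D t l' ω) fun u => r u ω := by
          refine Finset.prod_congr rfl fun l' hl' => ?_
          have hne : I (t + 1) ω ≠ l' := by
            rw [hω']
            exact (Finset.ne_of_mem_erase hl').symm
          have : D (t + 1) l' ω = D t l' ω := drawRounds_succ_of_ne (I := fun u => I u ω) hne
          rw [this]
        rw [this]
        ring
      · simp [hG, hωA]
    have e2 : ∀ ω, A.indicator (W t) ω = ∑' k, G k ω := by
      intro ω
      by_cases hωA : ω ∈ A
      · simp only [hG, Set.indicator_of_mem hωA, hWdef]
        rw [← Finset.mul_prod_erase _ _ (Finset.mem_univ l), hM, mul_comm,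
          ENNReal.tsum_mul_left]
      · simp [hG, hωA]
    rw [setLIntegral_congr_fun hSm e1, lintegral_congr e2,
      lintegral_tsum fun k => ((hGm' k).fun_mul ((hq l k).fun_comp hr)).aemeasurable,
      lintegral_tsum fun k => (hGm' k).aemeasurable]
    refine ENNReal.tsum_le_tsum fun k => ?_
    rw [h.setLIntegral_mul_reward hμ (hGm k) (hq l k)]
    exact mul_le_of_le_one_right' (hq1 l k)
  -- Before the first draw all products are empty, so only the masses remain.
  · have : ∀ ω, W 0 ω ≤ ∏ l, C l := by
      intro ω
      refine Finset.prod_le_prod' fun l _ => ?_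
      rw [hM]
      simpa [hD, drawRounds_zero] using hc l
    exact (lintegral_mono this).trans (by simp)

end IsSamplingProcess

/-! ### Inverting the threshold functions. -/

section Threshold

lemma one_le_hFun {x : ℝ} (hx : 0 < x) : 1 ≤ hFun x := by
  have := Real.log_le_sub_one_of_pos hx
  rw [hFun]
  linarith

lemma hFun_lt_hFun {a b : ℝ} (ha : 1 ≤ a) (hab : a < b) : hFun a < hFun b := by
  have ha0 : 0 < a := by linarith
  have hb0 : 0 < b := by linarith
  have h1 : Real.log (b / a) < b / a - 1 :=
    Real.log_lt_sub_one_of_pos (by positivity) (by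
      rw [ne_eq, div_eq_one_iff_eq ha0.ne']
      exact hab.ne')
  rw [Real.log_div hb0.ne' ha0.ne'] at h1
  have h2 : b / a - 1 ≤ b - a := by
    rw [div_sub_one ha0.ne', div_le_iff₀ ha0]
    nlinarith
  rw [hFun, hFun]
  linarith

lemma exists_hFun_eq {v : ℝ} (hv : 1 ≤ v) : ∃ x ∈ Ici (1 : ℝ), hFun x = v := by
  have hcont : ContinuousOn hFun (Icc 1 (2 * v)) := by
    refine continuousOn_id.sub (Real.continuousOn_log.mono fun x hx => ?_)
    simp only [mem_compl_iff, mem_singleton_iff]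
    linarith [hx.1]
  have h := intermediate_value_Icc (by linarith) hcont
  -- From `log 2 ≤ 1` and `log v ≤ v - 1`.
  have hle : v ≤ hFun (2 * v) := by
    have h1 := Real.log_le_sub_one_of_pos (show 0 < v by linarith)
    have h2 := Real.log_le_sub_one_of_pos (show (0 : ℝ) < 2 by norm_num)
    rw [hFun, Real.log_mul (by norm_num) (by linarith)]
    linarith
  obtain ⟨x, hx, hxv⟩ := h ⟨by simpa [hFun] using hv, hle⟩
  exact ⟨x, hx.1, hxv⟩

lemma one_le_hInv {v : ℝ} (hv : 1 ≤ v) : 1 ≤ hInv v :=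
  Function.invFunOn_mem (exists_hFun_eq hv)

lemma hFun_hInv {v : ℝ} (hv : 1 ≤ v) : hFun (hInv v) = v :=
  Function.invFunOn_eq (exists_hFun_eq hv)

/-- The value of `hTilde` is attained in the minimisation over `z` that it stands for. -/
lemma exists_hTilde_eq (w : ℝ) :
    ∃ z : ℝ, 1 < z ∧ z ≤ 3 / 2 ∧ hTilde w = z * (w - Real.log (Real.log z)) := by
  have hlog : 0 < Real.log (3 / 2) := Real.log_pos (by norm_num)
  have hlog1 : Real.log (3 / 2) ≤ 1 := by
    have := Real.log_le_sub_one_of_pos (show (0 : ℝ) < 3 / 2 by norm_num)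
    linarith
  by_cases h : hFun (1 / Real.log (3 / 2)) ≤ w
  · have hw : 1 ≤ w := (one_le_hFun (by positivity)).trans h
    have hu1 := one_le_hInv hw
    have hu := hFun_hInv hw
    set u := hInv w with hudef
    have hu0 : 0 < u := by linarith
    have hge : 1 / Real.log (3 / 2) ≤ u := by
      by_contra! hlt
      have := hFun_lt_hFun hu1 hlt
      linarith
    -- The critical point of `z (w - log (log z))` is `1 / log z = u` with `u - log u = w`; there
    -- the bracket equals `u`. The case condition says exactly that this `z` is at most `3 / 2`.
    refine ⟨Real.exp (1 / u), Real.one_lt_exp_iff.2 (by positivity), ?_, ?_⟩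
    · rw [← Real.le_log_iff_exp_le (by norm_num)]
      exact (one_div_le hlog hu0).1 hge
    · rw [hTilde, if_pos h, ← hudef, Real.log_exp, one_div, Real.log_inv]
      rw [hFun] at hu
      congr 1
      linarith
  · exact ⟨3 / 2, by norm_num, le_rfl, by rw [hTilde, if_neg h]⟩

end Threshold

/-! ### Almost sure sets of rewards and arms whose true law is a point mass. -/

namespace ExpFamily

variable {F : ExpFamily}

lemma density_le_inv {x : ℝ} (hx : x ∈ F.X) (y : ℝ) : F.density x y ≤ (F.base {y})⁻¹ := by
  rw [ENNReal.le_inv_iff_mul_le, ← lintegral_density hx, ← lintegral_singleton]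
  exact setLIntegral_le_lintegral _ _

lemma density_ne_top {x : ℝ} (y : ℝ) : F.density x y ≠ ⊤ := by
  by_cases h : IsExtremeAtom F.base x
  · rw [density_of_extreme h]
    split_ifs
    · simp [h.1.ne']
    · simp
  · rw [density, if_neg h]
    simp

/-- Sets of rewards that have full measure for the member with mean `x` and avoid degenerate
likelihoods. -/
lemma exists_rewards {x : ℝ} (hx : x ∈ F.X) :
    ∃ R : Set ℝ, MeasurableSet R ∧ R ⊆ F.X ∧ F.law x Rᶜ = 0 ∧ (∀ y ∈ R, F.density x y ≠ 0) ∧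
      (IsExtremeAtom F.base x → R ⊆ {x}) := by
  by_cases h : IsExtremeAtom F.base x
  · refine ⟨{x}, measurableSet_singleton x, by simpa using hx, ?_, ?_, fun _ => le_rfl⟩
    · rw [law, withDensity_apply _ (measurableSet_singleton x).compl,
        setLIntegral_congr_fun (g := fun _ => 0) (measurableSet_singleton x).compl fun y hy => ?_]
      · simp
      · exact (density_of_extreme h y).trans (if_neg hy)
    · rintro y rfl
      rw [density_of_extreme h, if_pos rfl]
      simpa using base_singleton_ne_top y
  · obtain ⟨R, hR, hRX, hR0⟩ := exists_measurable_rewards F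
    refine ⟨R, hR, hRX, withDensity_absolutelyContinuous _ _ hR0, fun y _ => ?_,
      fun h' => absurd h' h⟩
    rw [density_eq_exp hx h]
    simp [Real.exp_pos]

/-- No member has density above `(F.base {x})⁻¹` at `x`, as its mass there is at most one, and the
point mass attains this value. -/
lemma armRatio_le_one_of_extreme {x : ℝ} (h : IsExtremeAtom F.base x) {s : Finset ℕ} {r : ℕ → ℝ}
    (hr : ∀ u ∈ s, r u = x) : armRatio F x s r ≤ 1 := by
  rw [armRatio]
  refine ENNReal.div_le_of_le_mul ?_
  rw [one_mul]
  refine iSup₂_le fun x' hx' => Finset.prod_le_prod' fun u hu => ?_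
  rw [hr u hu, density_of_extreme h, if_pos rfl]
  exact density_le_inv hx' x

lemma one_le_armRatio {x : ℝ} (hx : x ∈ F.X) {s : Finset ℕ} {r : ℕ → ℝ}
    (hr : ∀ u ∈ s, F.density x (r u) ≠ 0) : 1 ≤ armRatio F x s r := by
  rw [armRatio, ENNReal.le_div_iff_mul_le
    (Or.inl (Finset.prod_ne_zero_iff.2 hr)) (Or.inl (ENNReal.prod_ne_top fun u _ =>
      density_ne_top _)), one_mul]
  exact le_iSup₂ (f := fun x' (_ : x' ∈ F.X) => ∏ u ∈ s, F.density x' (r u)) x hx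

lemma armRatio_ne_top {x : ℝ} {s : Finset ℕ} {r : ℕ → ℝ} (hrX : ∀ u ∈ s, r u ∈ F.X)
    (hr : ∀ u ∈ s, F.density x (r u) ≠ 0) : armRatio F x s r ≠ ⊤ :=
  ENNReal.div_ne_top (iSup_prod_density_ne_top hrX) (Finset.prod_ne_zero_iff.2 hr)

end ExpFamily

/-- Serves arms whose true law is a point mass, where `g ≤ 0`; the remaining terms have the right
sign because `log z ≤ 1`. -/
lemma armDeviation_nonpos {z g : ℝ} {n : ℕ} (hz1 : 1 < z) (hz2 : z ≤ 3 / 2) (hn : 0 < n)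
    (hg : g ≤ 0) : armDeviation z g n ≤ 0 := by
  have hz0 : 0 < z := by linarith
  have hlogz : 0 < Real.log z := Real.log_pos hz1
  have hlogz1 : Real.log z ≤ 1 := by
    have := Real.log_le_sub_one_of_pos hz0
    linarith
  have h1 : Real.log (Real.log z) ≤ 0 := Real.log_nonpos hlogz.le hlogz1
  have hn1 : (1 : ℝ) ≤ n := by exact_mod_cast hn
  have h2 : 0 ≤ Real.log (1 + Real.log n) :=
    Real.log_nonneg (by linarith [Real.log_nonneg hn1])
  have h3 : (g - 3 * Real.log (1 + Real.log n)) / z ≤ 0 :=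
    div_nonpos_of_nonpos_of_nonneg (by linarith) hz0.le
  have := log_pi_sq_div_three_pos
  rw [armDeviation]
  linarith

/-- `exists_mixture_exp` for all means, including the extreme atoms. -/
lemma exists_mixture_exp_of_mem {F : ExpFamily} {x : ℝ} (hx : x ∈ F.X) {R : Set ℝ}
    (hRX : R ⊆ F.X) (hRe : IsExtremeAtom F.base x → R ⊆ {x}) {z : ℝ} (hz1 : 1 < z)
    (hz2 : z ≤ 3 / 2) {l ε : ℝ} (hl0 : 0 ≤ l) (hl1 : l < 1) (hε : 0 < ε) :
    ∃ M, IsMixture (F.law x) (ENNReal.ofReal (mixtureMass l ε)) M ∧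
      ∀ (s : Finset ℕ) (r : ℕ → ℝ) (g : ℝ), s.Nonempty →
        (∀ u ∈ s, r u ∈ R) → ENNReal.ofReal (Real.exp g) ≤ armRatio F x s r →
        ENNReal.ofReal (Real.exp (l * armDeviation z g s.card)) ≤ M s r := by
  by_cases h : IsExtremeAtom F.base x
  · have := ExpFamily.isProbabilityMeasure_law hx
    refine ⟨_, IsMixture.const _, fun s r g hs hr hg => ENNReal.ofReal_le_ofReal ?_⟩
    refine le_trans ?_ (one_le_mixtureMass hl0 hl1 hε)
    have hg1 := hg.trans (ExpFamily.armRatio_le_one_of_extreme h fun u hu => hRe h (hr u hu))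
    rw [← ENNReal.ofReal_one, ENNReal.ofReal_le_ofReal_iff zero_le_one, Real.exp_le_one_iff] at hg1
    rw [Real.exp_le_one_iff]
    exact mul_nonpos_of_nonneg_of_nonpos hl0 (armDeviation_nonpos hz1 hz2 hs.card_pos hg1)
  · obtain ⟨M, hM, hle⟩ := exists_mixture_exp hx h hz1 hz2 hl0 hl1 hε
    exact ⟨M, hM, fun s r g hs hr hg => hle s r g hs (fun u hu => hRX (hr u hu)) hg⟩

/-! ### Probability of ever crossing the threshold. -/

/-- If the product of the likelihood ratios reaches the stopping threshold, then the sum of the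
deviations is large. -/
lemma card_mul_le_sum_armDeviation {L : Type} [Fintype L] [DecidableEq L] {I : ℕ → L} {t : ℕ}
    {δ z : ℝ} {g : L → ℝ} (hz : 0 < z)
    (hzeq : hTilde ((hInv (1 + Real.log (1 / δ) / Fintype.card L) + Real.log (Real.pi ^ 2 / 3)) / 2)
      = z * ((hInv (1 + Real.log (1 / δ) / Fintype.card L) + Real.log (Real.pi ^ 2 / 3)) / 2
        - Real.log (Real.log z)))
    (hg : threshold I t δ ≤ ∑ l, g l) :
    Fintype.card L * hInv (1 + Real.log (1 / δ) / Fintype.card L)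
      ≤ ∑ l, armDeviation z (g l) (drawRounds I t l).card := by
  -- The 2 in `cExp` undoes the halved argument, turning the second term of the threshold into `K z
  -- (y + log (π² / 3) - 2 log (log z))`, which matches the normalisation in `armDeviation`.
  rw [threshold, cExp, hzeq] at hg
  simp only [armDeviation, Finset.sum_sub_distrib, ← Finset.sum_div, ← Finset.mul_sum]
  simp only [Finset.sum_const, Finset.card_univ, nsmul_eq_mul]
  simp only [numDraws] at hg
  rw [le_sub_iff_add_le, le_div_iff₀ hz]
  linarith

/-- The probability that the likelihood ratios ever reach the stopping threshold. -/
theorem IsSamplingProcess.measure_exists_threshold_le {Ω : Type*} [MeasurableSpace Ω]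
    {P : Measure Ω} [IsProbabilityMeasure P]
    {ℱ : Filtration ℕ (inferInstance : MeasurableSpace Ω)} {F : ExpFamily} {L : Type} [Fintype L]
    [DecidableEq L] [Nonempty L] {μ : L → ℝ} {I : ℕ → Ω → L} {r : ℕ → Ω → ℝ}
    (h : IsSamplingProcess P ℱ F μ I r) (hμ : ∀ l, μ l ∈ F.X) {R : L → Set ℝ}
    (hRX : ∀ l, R l ⊆ F.X) (hR0 : ∀ l, ∀ y ∈ R l, F.density (μ l) y ≠ 0)
    (hRe : ∀ l, IsExtremeAtom F.base (μ l) → R l ⊆ {μ l}) {δ : ℝ} (hδ : 0 < δ) (hδ1 : δ < 1) :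
    P {ω | ∃ t, (∀ l, (drawRounds (fun u => I u ω) t l).Nonempty) ∧
        (∀ l, ∀ u ∈ drawRounds (fun u => I u ω) t l, r u ω ∈ R l) ∧
        ENNReal.ofReal (Real.exp (threshold (fun u => I u ω) t δ))
          ≤ ∏ l, armRatio F (μ l) (drawRounds (fun u => I u ω) t l) fun u => r u ω}
      ≤ ENNReal.ofReal δ := by
  set K : ℝ := (Fintype.card L : ℝ) with hK
  have hK0 : 0 < K := Nat.cast_pos.2 Fintype.card_pos
  set v : ℝ := Real.log (1 / δ) / K with hv
  have hlogδ : 0 < Real.log (1 / δ) := Real.log_pos (by rw [lt_div_iff₀ hδ]; linarith)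
  have hv0 : 0 < v := div_pos hlogδ hK0
  have hy1 : 1 ≤ hInv (1 + v) := one_le_hInv (by linarith)
  have hyv : hFun (hInv (1 + v)) = 1 + v := hFun_hInv (by linarith)
  obtain ⟨z, hz1, hz2, hzeq⟩ :=
    exists_hTilde_eq ((hInv (1 + v) + Real.log (Real.pi ^ 2 / 3)) / 2)
  set y := hInv (1 + v) with hy
  have hy0 : 0 < y := by linarith
  -- The minimiser of `exp (-l y) / (1 - l)`.
  set l₀ : ℝ := 1 - 1 / y with hl₀
  have hl0 : 0 ≤ l₀ := sub_nonneg.2 ((div_le_one hy0).2 hy1)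
  have hl1 : l₀ < 1 := by
    have : 0 < 1 / y := by positivity
    linarith
  set E := {ω | ∃ t, (∀ l, (drawRounds (fun u => I u ω) t l).Nonempty) ∧
        (∀ l, ∀ u ∈ drawRounds (fun u => I u ω) t l, r u ω ∈ R l) ∧
        ENNReal.ofReal (Real.exp (threshold (fun u => I u ω) t δ))
          ≤ ∏ l, armRatio F (μ l) (drawRounds (fun u => I u ω) t l) fun u => r u ω} with hE
  have hbound : ∀ ε, 0 < ε →
      Real.exp (l₀ * (K * y)) * P.real E ≤ mixtureMass l₀ ε ^ Fintype.card L := by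
    intro ε hε
    have hex := fun l => exists_mixture_exp_of_mem (hμ l) (hRX l) (hRe l) hz1 hz2 hl0 hl1 hε
    choose M hM hMle using hex
    have hville := h.mul_measure_exists_le_prod hμ hM (ENNReal.ofReal (Real.exp (l₀ * (K * y))))
    have hsub : E ⊆ {ω | ∃ t, ENNReal.ofReal (Real.exp (l₀ * (K * y)))
        ≤ ∏ l, M l (drawRounds (fun u => I u ω) t l) fun u => r u ω} := by
      rintro ω ⟨t, hne, hrR, hle⟩
      refine ⟨t, ?_⟩
      set G : L → ℝ≥0∞ := fun l =>
        armRatio F (μ l) (drawRounds (fun u => I u ω) t l) fun u => r u ω with hG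
      have hG1 : ∀ l, 1 ≤ G l := fun l =>
        ExpFamily.one_le_armRatio (hμ l) fun u hu => hR0 l _ (hrR l u hu)
      have hGtop : ∀ l, G l ≠ ⊤ := fun l =>
        ExpFamily.armRatio_ne_top (fun u hu => hRX l (hrR l u hu)) fun u hu =>
          hR0 l _ (hrR l u hu)
      have hGpos : ∀ l, 0 < (G l).toReal := fun l =>
        ENNReal.toReal_pos (one_pos.trans_le (hG1 l)).ne' (hGtop l)
      set g : L → ℝ := fun l => Real.log (G l).toReal with hg
      have hGg : ∀ l, ENNReal.ofReal (Real.exp (g l)) = G l := fun l => by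
        rw [hg, Real.exp_log (hGpos l), ENNReal.ofReal_toReal (hGtop l)]
      have hthr : threshold (fun u => I u ω) t δ ≤ ∑ l, g l := by
        rw [← Finset.prod_congr rfl fun l _ => hGg l,
          ← ENNReal.ofReal_prod_of_nonneg fun _ _ => (Real.exp_pos _).le, ← Real.exp_sum,
          ENNReal.ofReal_le_ofReal_iff (Real.exp_pos _).le, Real.exp_le_exp] at hle
        exact hle
      have hdev := card_mul_le_sum_armDeviation (by linarith) hzeq hthr
      calc ENNReal.ofReal (Real.exp (l₀ * (K * y)))
          ≤ ENNReal.ofReal (Real.exp (∑ l, l₀ *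
              armDeviation z (g l) (drawRounds (fun u => I u ω) t l).card)) := by
            rw [← Finset.mul_sum]
            exact ENNReal.ofReal_le_ofReal (Real.exp_le_exp.2
              (mul_le_mul_of_nonneg_left hdev hl0))
        _ = ∏ l, ENNReal.ofReal (Real.exp (l₀ *
              armDeviation z (g l) (drawRounds (fun u => I u ω) t l).card)) := by
            rw [Real.exp_sum, ENNReal.ofReal_prod_of_nonneg fun _ _ => (Real.exp_pos _).le]
        _ ≤ _ := Finset.prod_le_prod' fun l _ =>
            hMle l _ _ (g l) (hne l) (hrR l) (hGg l).le
    have hm0 : 0 ≤ mixtureMass l₀ ε := zero_le_one.trans (one_le_mixtureMass hl0 hl1 hε)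
    rw [Finset.prod_const, Finset.card_univ, ← ENNReal.ofReal_pow hm0] at hville
    have h1 : ENNReal.ofReal (Real.exp (l₀ * (K * y))) * P E
        ≤ ENNReal.ofReal (mixtureMass l₀ ε ^ Fintype.card L) :=
      le_trans (by gcongr) hville
    have h2 := ENNReal.toReal_mono ENNReal.ofReal_ne_top h1
    rwa [ENNReal.toReal_mul, ENNReal.toReal_ofReal (Real.exp_pos _).le,
      ENNReal.toReal_ofReal (pow_nonneg hm0 _)] at h2
  -- The event does not depend on the grid width, so `ε` may tend to zero.
  have hlim : Real.exp (l₀ * (K * y)) * P.real E ≤ (1 / (1 - l₀)) ^ Fintype.card L := by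
    refine ge_of_tendsto ((tendsto_mixtureMass hl1).pow _) ?_
    filter_upwards [self_mem_nhdsWithin] with ε hε
    exact hbound ε hε
  -- On taking logs this is `K` times `y - log y = 1 + v`.
  have hfin : Real.exp (l₀ * (K * y)) * δ = (1 / (1 - l₀)) ^ Fintype.card L := by
    have e1 : 1 / (1 - l₀) = y := by
      rw [hl₀, sub_sub_cancel, one_div_one_div]
    have e2 : l₀ * (K * y) = K * (y - 1) := by
      rw [hl₀]
      field_simp
    have e3 : δ = Real.exp (-(K * v)) := by
      rw [hv, mul_div_cancel₀ _ hK0.ne', one_div, Real.log_inv, neg_neg, Real.exp_log hδ]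
    have e4 : y ^ Fintype.card L = Real.exp (K * Real.log y) := by
      rw [hK, Real.exp_nat_mul, Real.exp_log hy0]
    rw [e1, e2, e4]
    nth_rewrite 1 [e3]
    rw [← Real.exp_add]
    rw [hFun] at hyv
    congr 1
    linear_combination K * hyv
  rw [← hfin] at hlim
  have hreal : P.real E ≤ δ := le_of_mul_le_mul_left hlim (Real.exp_pos _)
  rw [← ENNReal.ofReal_toReal (measure_ne_top P E)]
  exact ENNReal.ofReal_le_ofReal hreal

/-! ### Splitting the tree at the root. -/

namespace GameTree

instance instNonemptyLeaf : (T : GameTree) → Nonempty T.Leaf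
  | leaf => ⟨()⟩
  | node _ _ child => (instNonemptyLeaf (child 0)).map (inChild child 0)

lemma exists_eq_inChild {label : NodeLabel} {n : ℕ} (child : Fin (n + 1) → GameTree)
    (l : (node label n child).Leaf) : ∃ c l', l = inChild child c l' :=
  ⟨l.1, l.2, rfl⟩

lemma prod_leaf {label : NodeLabel} {n : ℕ} (child : Fin (n + 1) → GameTree)
    {α : Type*} [CommMonoid α] (f : (node label n child).Leaf → α) :
    ∏ l, f l = ∏ c, ∏ l, f (inChild child c l) :=
  Fintype.prod_sigma (ι := Fin (n + 1)) (α := fun i => (child i).Leaf) f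

open Classical in
/-- The leaf values that agree with `v₁` below the `c`-th child and with `v₂` elsewhere. -/
noncomputable def glue {label : NodeLabel} {n : ℕ} (child : Fin (n + 1) → GameTree)
    (c : Fin (n + 1)) (v₁ : (child c).Leaf → ℝ) (v₂ : (node label n child).Leaf → ℝ) :
    (node label n child).Leaf → ℝ := fun l =>
  Function.update (fun c' l' => v₂ (inChild child c' l')) c v₁ l.1 l.2

lemma glue_inChild_self {label : NodeLabel} {n : ℕ} (child : Fin (n + 1) → GameTree)
    (c : Fin (n + 1)) (v₁ : (child c).Leaf → ℝ) (v₂ : (node label n child).Leaf → ℝ)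
    (l : (child c).Leaf) : glue child c v₁ v₂ (inChild child c l) = v₁ l := by
  simp [glue, inChild]

lemma glue_inChild_of_ne {label : NodeLabel} {n : ℕ} (child : Fin (n + 1) → GameTree)
    {c c' : Fin (n + 1)} (h : c' ≠ c) (v₁ : (child c).Leaf → ℝ)
    (v₂ : (node label n child).Leaf → ℝ) (l : (child c').Leaf) :
    glue child c v₁ v₂ (inChild child c' l) = v₂ (inChild child c' l) := by
  simp [glue, inChild, h]

end GameTree

open GameTree

lemma answer_ne_win_iff {θ : ℝ} {T : GameTree} {v : T.Leaf → ℝ} :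
    answer θ T v ≠ Answer.win ↔ T.value v < θ := by
  unfold answer
  split_ifs with h
  · simpa using h
  · simpa using h

lemma answer_ne_lose_iff {θ : ℝ} {T : GameTree} {v : T.Leaf → ℝ} :
    answer θ T v ≠ Answer.lose ↔ θ ≤ T.value v := by
  unfold answer
  split_ifs with h <;> simp [h]

lemma goodChildren_nonempty_iff {θ : ℝ} {n : ℕ} {child : Fin (n + 1) → GameTree}
    {v : (maxRoot child).Leaf → ℝ} :
    (goodChildren θ child v).Nonempty ↔ θ ≤ (maxRoot child).value v := by
  rw [GameTree.value, Finset.le_sup'_iff]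
  simp [goodChildren, childValue, Set.Nonempty]

/-! ### GLR statistics of the root and of its children. -/

section LikelihoodRatio

variable {L : Type} [DecidableEq L] {F : ExpFamily} {I : ℕ → L} {r : ℕ → ℝ} {t : ℕ}

/-- The vector `v` competes in the denominator, and the numerator is relaxed to separate maxima over
the arms. Nonzero likelihoods allow the quotient of products to be split. -/
lemma logLikelihoodRatio_le {S : GameTree} {e : S.Leaf → L} {A : Set (S.Leaf → ℝ)}
    {v : S.Leaf → ℝ} (hv : v ∈ A)
    (hne : ∀ l, ∀ u ∈ drawRounds I t (e l), F.density (v l) (r u) ≠ 0) :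
    logLikelihoodRatio F S e I r t A
      ≤ ENNReal.log (∏ l, armRatio F (v l) (drawRounds I t (e l)) r) := by
  refine ENNReal.log_le_log ?_
  simp only [armRatio]
  rw [ENNReal.prod_div_distrib_of_ne_zero fun l _ => Finset.prod_ne_zero_iff.2 (hne l)]
  refine ENNReal.div_le_div (iSup₂_le fun w hw => Finset.prod_le_prod' fun l _ => ?_) ?_
  · exact le_iSup₂ (f := fun x (_ : x ∈ F.X) => ∏ u ∈ drawRounds I t (e l), F.density x (r u))
      (w l) (hw l)
  · exact le_iSup₂ (f := fun w (_ : w ∈ A) => likelihood F S e I r t w) v hv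

lemma ofReal_exp_le_of_le_log {b : ℝ} {x : ℝ≥0∞} (h : (b : EReal) ≤ ENNReal.log x) :
    ENNReal.ofReal (Real.exp b) ≤ x := by
  rw [← ENNReal.log_le_log_iff, ENNReal.log_ofReal_of_pos (Real.exp_pos _), Real.log_exp]
  exact h

end LikelihoodRatio

section Root

variable {F : ExpFamily} {θ : ℝ} {n : ℕ} {child : Fin (n + 1) → GameTree}
  {I : ℕ → (maxRoot child).Leaf} {r : ℕ → ℝ} {t : ℕ}

lemma likelihood_maxRoot (v : (maxRoot child).Leaf → ℝ) (c : Fin (n + 1)) :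
    likelihood F (maxRoot child) id I r t v
      = likelihood F (child c) (inChild child c) I r t (fun l => v (inChild child c l)) *
        ∏ c' ∈ Finset.univ.erase c,
          likelihood F (child c') (inChild child c') I r t fun l => v (inChild child c' l) := by
  rw [likelihood, prod_leaf, ← Finset.mul_prod_erase _ _ (Finset.mem_univ c)]
  rfl

/-- A constraint on one child leaves the maximisation over the other children unaffected. -/
lemma iSup_likelihood_maxRoot (c : Fin (n + 1)) {A : Set ((child c).Leaf → ℝ)}
    (hA : A ⊆ F.meanVectors (child c)) :
    ⨆ v ∈ {v | v ∈ F.meanVectors (maxRoot child) ∧ (fun l => v (inChild child c l)) ∈ A},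
        likelihood F (maxRoot child) id I r t v
      = (⨆ v ∈ A, likelihood F (child c) (inChild child c) I r t v) *
        ⨆ v ∈ F.meanVectors (maxRoot child), ∏ c' ∈ Finset.univ.erase c,
          likelihood F (child c') (inChild child c') I r t fun l => v (inChild child c' l) := by
  refine le_antisymm (iSup₂_le fun v hv => ?_) ?_
  · rw [likelihood_maxRoot v c]
    refine mul_le_mul' ?_ ?_
    · exact le_iSup₂ (f := fun w (_ : w ∈ A) =>
        likelihood F (child c) (inChild child c) I r t w) _ hv.2
    · exact le_iSup₂ (f := fun (v : (maxRoot child).Leaf → ℝ)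
        (_ : v ∈ F.meanVectors (maxRoot child)) => ∏ c' ∈ Finset.univ.erase c,
          likelihood F (child c') (inChild child c') I r t fun l => v (inChild child c' l)) v hv.1
  -- A candidate below `c` and a candidate elsewhere are glued into one admissible vector.
  · simp only [ENNReal.iSup_mul, ENNReal.mul_iSup]
    refine iSup₂_le fun v₂ hv₂ => iSup₂_le fun v₁ hv₁ => ?_
    have hself : (fun l => glue child c v₁ v₂ (inChild child c l)) = v₁ :=
      funext fun l => glue_inChild_self child c v₁ v₂ l
    refine le_trans (le_of_eq ?_) (le_iSup₂ (f := fun v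
      (_ : v ∈ {v | v ∈ F.meanVectors (maxRoot child) ∧
        (fun l => v (inChild child c l)) ∈ A}) => likelihood F (maxRoot child) id I r t v)
        (glue child c v₁ v₂) ⟨fun l => ?_, ?_⟩)
    · rw [likelihood_maxRoot _ c, hself]
      congr 1
      refine Finset.prod_congr rfl fun c' hc' => ?_
      congr 1
      exact funext fun l =>
        (glue_inChild_of_ne child (Finset.ne_of_mem_erase hc') v₁ v₂ l).symm
    · obtain ⟨c', l', rfl⟩ := exists_eq_inChild child l
      by_cases h : c' = c
      · subst h
        rw [glue_inChild_self]
        exact hA hv₁ l'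
      · rw [glue_inChild_of_ne child h]
        exact hv₂ _
    · rw [hself]
      exact hv₁

lemma altGAI_none_eq :
    altGAI F θ child none = F.alt θ (maxRoot child) Answer.lose := by
  ext v
  simp only [altGAI, ExpFamily.alt, Set.mem_ofPred_eq, answer_ne_lose_iff]

lemma altGAI_some_eq (c : Fin (n + 1)) :
    altGAI F θ child (some c) = {v | v ∈ F.meanVectors (maxRoot child) ∧
      (fun l => v (inChild child c l)) ∈ F.alt θ (child c) Answer.win} := by
  ext v
  simp only [altGAI, ExpFamily.alt, Set.mem_ofPred_eq, answer_ne_win_iff, childValue]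
  exact ⟨fun h => ⟨h.1, fun l => h.1 _, h.2⟩, fun h => ⟨h.1, h.2.2⟩⟩

lemma estAnswer_eq_lose_iff :
    estAnswer θ child I r t = Answer.lose ↔ (maxRoot child).value (empMean I r t) < θ := by
  rw [estAnswer, ← not_iff_not, ← ne_eq, answer_ne_lose_iff, not_lt]

lemma estAnswer_eq_win_iff :
    estAnswer θ child I r t = Answer.win ↔ θ ≤ (maxRoot child).value (empMean I r t) := by
  rw [estAnswer, ← not_iff_not, ← ne_eq, answer_ne_win_iff, not_le]

/-- The alternative to output `c` restricts only leaves below `c`, so numerator and denominator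
share the factor `B` of the other children. It is nonzero because `μ` has positive likelihood, and
finite because the rewards lie in `F.X`. -/
lemma gaiGLR_some_eq_childGLR {μ : (maxRoot child).Leaf → ℝ}
    (hμ : μ ∈ F.meanVectors (maxRoot child))
    (hrX : ∀ l, ∀ u ∈ drawRounds I t l, r u ∈ F.X)
    (hne : ∀ l, ∀ u ∈ drawRounds I t l, F.density (μ l) (r u) ≠ 0)
    (hwin : estAnswer θ child I r t = Answer.win) (c : Fin (n + 1)) :
    gaiGLR F θ child I r t (some c) = childGLR F θ child I r t c := by
  rw [gaiGLR, childGLR, logLikelihoodRatio, logLikelihoodRatio, altGAI_some_eq, hwin,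
    iSup_likelihood_maxRoot c fun v hv => hv.1]
  have htop : F.meanVectors (maxRoot child) = {v | v ∈ F.meanVectors (maxRoot child) ∧
      (fun l => v (inChild child c l)) ∈ F.meanVectors (child c)} := by
    ext v
    exact ⟨fun h => ⟨h, fun l => h _⟩, fun h => h.1⟩
  set B := ⨆ v ∈ F.meanVectors (maxRoot child), ∏ c' ∈ Finset.univ.erase c,
    likelihood F (child c') (inChild child c') I r t fun l => v (inChild child c' l) with hB
  have hnum : ⨆ v ∈ F.meanVectors (maxRoot child), likelihood F (maxRoot child) id I r t v
      = (⨆ v ∈ F.meanVectors (child c), likelihood F (child c) (inChild child c) I r t v) * B := by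
    conv_lhs => rw [htop]
    exact iSup_likelihood_maxRoot c le_rfl
  have hB0 : B ≠ 0 := by
    refine ne_of_gt (lt_of_lt_of_le (pos_iff_ne_zero.2 ?_) (le_iSup₂ (f := fun
      (v : (maxRoot child).Leaf → ℝ) (_ : v ∈ F.meanVectors (maxRoot child)) =>
      ∏ c' ∈ Finset.univ.erase c,
        likelihood F (child c') (inChild child c') I r t fun l => v (inChild child c' l)) μ hμ))
    exact Finset.prod_ne_zero_iff.2 fun c' _ => Finset.prod_ne_zero_iff.2 fun l _ =>
      Finset.prod_ne_zero_iff.2 fun u hu => hne _ u hu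
  have hBtop : B ≠ ⊤ := by
    refine ne_top_of_le_ne_top (ENNReal.prod_ne_top (s := Finset.univ.erase c)
      (f := fun c' => ∏ l, ⨆ x ∈ F.X, ∏ u ∈ drawRounds I t (inChild child c' l),
        F.density x (r u)) fun c' _ => ENNReal.prod_ne_top fun l _ =>
          ExpFamily.iSup_prod_density_ne_top (hrX _)) ?_
    refine iSup₂_le fun v hv => Finset.prod_le_prod' fun c' _ => Finset.prod_le_prod' fun l _ => ?_
    exact le_iSup₂ (f := fun x (_ : x ∈ F.X) =>
      ∏ u ∈ drawRounds I t (inChild child c' l), F.density x (r u)) _ (hv _)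
  rw [hnum, ENNReal.mul_div_mul_right _ _ hB0 hBtop]

lemma gaiGLR_eq_of_win {μ : (maxRoot child).Leaf → ℝ} (hμ : μ ∈ F.meanVectors (maxRoot child))
    (hrX : ∀ l, ∀ u ∈ drawRounds I t l, r u ∈ F.X)
    (hne : ∀ l, ∀ u ∈ drawRounds I t l, F.density (μ l) (r u) ≠ 0)
    {out : Option (Fin (n + 1))} (hout : IsGAIOutput F θ child I r t out)
    (hwin : estAnswer θ child I r t = Answer.win) :
    gaiGLR F θ child I r t out = maxChildGLR F θ child I r t := by
  obtain ⟨c, rfl, hc⟩ := hout.1 (goodChildren_nonempty_iff.2 (estAnswer_eq_win_iff.1 hwin))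
  rw [gaiGLR_some_eq_childGLR hμ hrX hne hwin]
  exact le_antisymm (Finset.le_sup' _ (Finset.mem_univ c)) (Finset.sup'_le _ _ fun c' _ => hc c')

lemma gaiGLR_eq_of_lose {out : Option (Fin (n + 1))} (hout : IsGAIOutput F θ child I r t out)
    (hlose : estAnswer θ child I r t = Answer.lose) :
    gaiGLR F θ child I r t out = rootGLR F θ child I r t := by
  have hempty : goodChildren θ child (empMean I r t) = ∅ := by
    rw [← Set.not_nonempty_iff_eq_empty, goodChildren_nonempty_iff, not_le]
    exact estAnswer_eq_lose_iff.1 hlose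
  rw [hout.2 hempty, gaiGLR, rootGLR, hlose, altGAI_none_eq]

/-- If the output is incorrect while the stopping statistic is at least `b`, then so is the
likelihood ratio against the true means. -/
lemma le_prod_armRatio_of_incorrect {μ : (maxRoot child).Leaf → ℝ}
    (hμ : μ ∈ F.meanVectors (maxRoot child))
    (hne : ∀ l, ∀ u ∈ drawRounds I t l, F.density (μ l) (r u) ≠ 0)
    {out : Option (Fin (n + 1))} (hout : IsGAIOutput F θ child I r t out)
    (hinc : ¬ IsCorrectOutput θ child μ out) {b : ℝ}
    (hb : (b : EReal) ≤ gaiStatistic F θ child I r t) :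
    ENNReal.ofReal (Real.exp b) ≤ ∏ l, armRatio F (μ l) (drawRounds I t l) r := by
  rw [gaiStatistic] at hb
  split_ifs at hb with hval
  · obtain ⟨c, rfl, hc⟩ := hout.1 (goodChildren_nonempty_iff.2 hval)
    have hwin := estAnswer_eq_win_iff.2 hval
    have hb' : (b : EReal) ≤ childGLR F θ child I r t c :=
      hb.trans (Finset.sup'_le _ _ fun c' _ => hc c')
    have hμc : (fun l => μ (inChild child c l)) ∈ F.alt θ (child c) Answer.win :=
      ⟨fun l => hμ _, answer_ne_win_iff.2 (not_le.1 hinc)⟩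
    rw [childGLR, hwin] at hb'
    refine (ofReal_exp_le_of_le_log (hb'.trans (logLikelihoodRatio_le hμc fun l =>
      hne (inChild child c l)))).trans ?_
    rw [prod_leaf, ← Finset.mul_prod_erase _ _ (Finset.mem_univ c)]
    -- Leaves outside child `c` can only increase the product.
    exact le_mul_of_one_le_right' (Finset.one_le_prod' fun c' _ => Finset.one_le_prod' fun l _ =>
      ExpFamily.one_le_armRatio (hμ _) (hne _))
  · have hlose := estAnswer_eq_lose_iff.2 (not_le.1 hval)
    have hempty : goodChildren θ child (empMean I r t) = ∅ := by
      rw [← Set.not_nonempty_iff_eq_empty, goodChildren_nonempty_iff]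
      exact hval
    rw [hout.2 hempty] at hinc
    have hμa : μ ∈ F.alt θ (maxRoot child) Answer.lose :=
      ⟨hμ, answer_ne_lose_iff.2 (goodChildren_nonempty_iff.1
        (Set.nonempty_iff_ne_empty.2 hinc))⟩
    rw [rootGLR, hlose] at hb
    exact ofReal_exp_le_of_le_log (hb.trans (logLikelihoodRatio_le (e := id) hμa hne))

/-- A finite infimum in `ℕ∞` is over a nonempty set of naturals and is attained. -/
lemma gaiStoppingTime_spec {δ : ℝ} (h : gaiStoppingTime F θ child δ I r < ⊤) :
    Fintype.card (maxRoot child).Leaf < (gaiStoppingTime F θ child δ I r).toNat ∧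
      (threshold I (gaiStoppingTime F θ child δ I r).toNat δ : EReal)
        ≤ gaiStatistic F θ child I r (gaiStoppingTime F θ child δ I r).toNat := by
  set p : ℕ → Prop := fun t => Fintype.card (maxRoot child).Leaf < t ∧
    (threshold I t δ : EReal) ≤ gaiStatistic F θ child I r t with hp
  have hex : ∃ t, p t := by
    by_contra! hcon
    refine h.ne (iInf_eq_top.2 fun t => iInf_eq_top.2 fun ht => absurd ht (hcon t))
  classical
  have heq : gaiStoppingTime F θ child δ I r = (Nat.find hex : ℕ∞) := by
    refine le_antisymm (iInf₂_le (Nat.find hex) (Nat.find_spec hex)) ?_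
    exact le_iInf₂ fun t ht => Nat.cast_le.2 (Nat.find_min' hex ht)
  rw [heq, ENat.toNat_natCast]
  exact Nat.find_spec hex

end Root

end TMCTS

/-! ### The theorem. -/

theorem mainTheorem10 {Ω : Type*} [MeasurableSpace Ω] (P : Measure Ω) [IsProbabilityMeasure P]
    (ℱ : Filtration ℕ (inferInstance : MeasurableSpace Ω))
    (F : ExpFamily) {n : ℕ} (child : Fin (n + 1) → GameTree)
    (θ : ℝ) (hθ : θ ∈ F.X) (δ : ℝ) (hδ : 0 < δ)
    (μ : (maxRoot child).Leaf → ℝ) (hμ : μ ∈ F.meanVectors (maxRoot child))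
    (I : ℕ → Ω → (maxRoot child).Leaf) (r : ℕ → Ω → ℝ)
    (hproc : IsSamplingProcess P ℱ F μ I r)
    (hsampling : ∀ᵐ ω ∂P, FollowsRDTracking F θ (maxRoot child) (fun t => I t ω) (fun t => r t ω))
    (out : ℕ → Ω → Option (Fin (n + 1)))
    (hout : ∀ᵐ ω ∂P, ∀ t, Fintype.card (maxRoot child).Leaf ≤ t →
      IsGAIOutput F θ child (fun u => I u ω) (fun u => r u ω) t (out t ω)) :
    P {ω | gaiStoppingTime F θ child δ (fun u => I u ω) (fun u => r u ω) < ⊤ ∧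
        ¬ IsCorrectOutput θ child μ
          (out (gaiStoppingTime F θ child δ (fun u => I u ω) (fun u => r u ω)).toNat ω)}
      ≤ ENNReal.ofReal δ ∧
    ∀ᵐ ω ∂P, ∀ t, Fintype.card (maxRoot child).Leaf ≤ t →
      (estAnswer θ child (fun u => I u ω) (fun u => r u ω) t = Answer.lose →
        gaiGLR F θ child (fun u => I u ω) (fun u => r u ω) t (out t ω)
          = rootGLR F θ child (fun u => I u ω) (fun u => r u ω) t) ∧
      (estAnswer θ child (fun u => I u ω) (fun u => r u ω) t = Answer.win →
        gaiGLR F θ child (fun u => I u ω) (fun u => r u ω) t (out t ω)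
          = maxChildGLR F θ child (fun u => I u ω) (fun u => r u ω) t) := by
  have hex := fun l => ExpFamily.exists_rewards (hμ l)
  choose R hRm hRX hRlaw hR0 hRe using hex
  have hrew : ∀ᵐ ω ∂P, ∀ t l, ∀ u ∈ drawRounds (fun u => I u ω) t l, r u ω ∈ R l := by
    filter_upwards [hproc.ae_reward_mem hμ hRm hRlaw] with ω hω t l u hu
    simp only [drawRounds, Finset.mem_filter, Finset.mem_Icc] at hu
    obtain ⟨v, rfl⟩ := Nat.exists_eq_add_of_le' hu.1.1
    rw [← hu.2]
    exact hω v
  refine ⟨?_, ?_⟩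
  · rcases le_or_gt 1 δ with hδ1 | hδ1
    -- For `δ ≥ 1` the bound is trivial; the crossing estimate needs `log (1 / δ) > 0`.
    · refine prob_le_one.trans ?_
      rw [← ENNReal.ofReal_one]
      exact ENNReal.ofReal_le_ofReal hδ1
    · refine le_trans (measure_mono_ae ?_)
        (hproc.measure_exists_threshold_le hμ hRX hR0 hRe hδ hδ1)
      filter_upwards [hrew, hsampling, hout] with ω hω hs ho
      rintro ⟨hfin, hinc⟩
      obtain ⟨hcard, hthr⟩ := gaiStoppingTime_spec hfin
      refine ⟨_, fun l => ?_, hω _, le_prod_armRatio_of_incorrect hμ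
        (fun l u hu => hR0 l _ (hω _ l u hu)) (ho _ hcard.le) hinc hthr⟩
      -- The initial draws give every leaf a positive count by the stopping time, as the slicing of
      -- `n` requires.
      refine Finset.Nonempty.mono (drawRounds_mono _ hcard.le l) (Finset.card_pos.1 ?_)
      have := hs.1 l
      rw [numDraws] at this
      omega
  · filter_upwards [hrew, hout] with ω hω ho t ht
    exact ⟨gaiGLR_eq_of_lose (ho t ht), gaiGLR_eq_of_win hμ
      (fun l u hu => hRX l (hω t l u hu)) (fun l u hu => hR0 l _ (hω t l u hu)) (ho t ht)⟩
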